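/- **Setting.** Let $D=\{(z_k,c_k)\}_{k=1}^N$ be reflectionless scattering data: $z_1,\dots,z_N$ are distinct points of the open upper half plane, $c_k\neq 0$, and $D$ is invariant under $(z,c)\mapsto(-\bar z,-\bar c)$. Put $\mathcal Z=\{z_k\}$, $\sigma_2=\begin{pmatrix}0&-i\\ i&0\end{pmatrix}$. For real $y,t$ let $t\theta(z)=zy-\frac{t}{4z}$ and $\gamma_k=c_k e^{2it\theta(z_k)}$, and for $\Delta\subseteq\{1,\dots,N\}$ let $a_\Delta(z)=\prod_{k\in\Delta}\frac{z-z_k}{z-\bar z_k}$. The renormalized discrete Riemann–Hilbert problem asks for a $2\times2$ matrix function $m=m^\Delta(z;y,t|D)$ such that * $m$ is analytic in $\mathbb C\setminus(\mathcal Z\cup\bar{\mathcal Z})$, $m(z)=\sigma_2\overline{m(\bar z)}\sigma_2=\overline{m(-\bar z)}$, and $m(z)=I+O(z^{-1})$ as $z\to\infty$; * $m$ has at most simple poles at $z_k,\bar z_k$, with $\operatorname{Res}_{z=z_k}m=\lim_{z\to z_k}m(z)\tau_k$ and $\operatorname{Res}_{z=\bar z_k}m=\lim_{z\to \bar z_k}m(z)\,\sigma_2\overline{\tau_k}\sigma_2$,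 where $\tau_k=\begin{pmatrix}0&\gamma_k a_\Delta(z_k)^2\\0&0\end{pmatrix}$ if $k\notin\Delta$ and $\tau_k=\begin{pmatrix}0&0\\ \gamma_k^{-1}a_\Delta'(z_k)^{-2}&0\end{pmatrix}$ if $k\in\Delta$. For $\xi=y/t<0$ let $z_0=\sqrt{-1/(4\xi)}$ and let $\Delta^-$ be $\{k:|z_k|>z_0\}$ if $t>0$ and $\{k:|z_k|<z_0\}$ if $t<0$. Let $y_1\le y_2$ and $v_1\le v_2<0$, and put $$C(y_1,y_2,v_1,v_2)=\{(y,t): y=y_0+vt,\ y_0\in[y_1,y_2],\ v\in[v_1,v_2]\},\qquad I=\Big\{z:-\tfrac1{4v_1}<|z|^2<-\tfrac1{4v_2}\Big\}.$$ Let $D(I)=\{(z_k,c_k(I)): z_k\in I\}$ with $c_k(I)=c_k\prod_{n\in\Delta^-,\,z_n\notin I}\big(\frac{z_k-z_n}{z_k-\bar z_n}\big)^2$; for $D(I)$ the renormalization uses the indices of $\Delta^-$ whose poles lie in $I$. Finally let $$\mu(I)=\min_{z_k\notin I}\ \operatorname{Im}(z_k)\,\frac{-v_2}{|z_k|^2}\Big(|z_k|+\frac1{2\sqrt{-v_1}}\Big)\operatorname{dist}(z_k,\bar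 I),\qquad \bar I=\Big\{-\tfrac1{4v_1}\le|z|^2\le-\tfrac1{4v_2}\Big\}.$$ **Lemma.** For all real $y,t$ with $y/t<0$ the solutions $m^{\Delta^-}(z;y,t|D)$ and $m^{\Delta^-}(z;y,t|D(I))$ exist and are unique. If some $z_k\notin I$, then as $|t|\to\infty$ with $(y,t)\in C(y_1,y_2,v_1,v_2)$, $$m^{\Delta^-}(z;y,t|D)=\big(I+O(e^{-2\mu(I)|t|})\big)\,m^{\Delta^-}(z;y,t|D(I)),$$ where, for every $\varepsilon>0$, the error is uniform in $(y,t)$ in the cone and in all $z\notin\mathcal Z\cup\bar{\mathcal Z}$ at distance at least $\varepsilon$ from every $z_k$ and $\bar z_k$ with $z_k\notin I$. If all $z_k\in I$, the two solutions coincide for all real $y,t$ with $y/t<0$. -/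

import Mathlib

open Filter Topology

/-- Discrete data: poles `z k` (in the upper half plane) with norming constants `c k`. -/
structure DiscreteData (ι : Type*) where
  z : ι → ℂ
  c : ι → ℂ

namespace DiscreteData

variable {ι : Type*}

/-- Admissible reflectionless scattering data: distinct poles in the open upper half plane, nonzero
norming constants, and the symmetry `(z, c) ↦ (-z̄, -c̄)` of the data of a real potential (this is
what the symmetry `m(z) = conj (m(-z̄))` of the Riemann-Hilbert problem means for the data). -/
structure IsReflectionless (D : DiscreteData ι) : Prop where
  im_pos : ∀ k, 0 < (D.z k).im
  injective : Function.Injective D.z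
  c_ne_zero : ∀ k, D.c k ≠ 0
  symm : ∀ k, ∃ j, D.z j = -(starRingEnd ℂ) (D.z k) ∧ D.c j = -(starRingEnd ℂ) (D.c k)

/-- The set of all the poles `z k` and their complex conjugates. -/
def poles (D : DiscreteData ι) : Set ℂ :=
  {w | ∃ k, w = D.z k ∨ w = (starRingEnd ℂ) (D.z k)}

/-- `t θ(z) = z y - t / (4 z)`. -/
noncomputable def tTheta (y t : ℝ) (z : ℂ) : ℂ :=
  z * (y : ℂ) - (t : ℂ) / (4 * z)

/-- `γ_k = c_k e^{2 i t θ(z_k)}`. -/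
noncomputable def gam (D : DiscreteData ι) (y t : ℝ) (k : ι) : ℂ :=
  D.c k * Complex.exp (2 * Complex.I * tTheta y t (D.z k))

/-- The partial transmission coefficient
`a_Δ(z) = ∏_{k ∈ Δ} (z - z_k) / (z - z̄_k)`. -/
noncomputable def aDelta [Fintype ι] (D : DiscreteData ι) (Δ : Set ι) (z : ℂ) : ℂ :=
  open Classical in
  ∏ k ∈ Finset.univ.filter (fun k => k ∈ Δ), (z - D.z k) / (z - (starRingEnd ℂ) (D.z k))

/-- The Pauli matrix `σ₂`. -/
def sigma2 : Matrix (Fin 2) (Fin 2) ℂ :=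
  !![0, -Complex.I; Complex.I, 0]

/-- The nilpotent residue matrix at `z_k`: upper triangular with entry `γ_k a_Δ(z_k)²` if `k ∉ Δ`,
lower triangular with entry `γ_k⁻¹ a_Δ'(z_k)⁻²` if `k ∈ Δ`. -/
noncomputable def tau [Fintype ι] (D : DiscreteData ι) (Δ : Set ι) (y t : ℝ) (k : ι) :
    Matrix (Fin 2) (Fin 2) ℂ :=
  open Classical in
  if k ∈ Δ then
    !![0, 0; (D.gam y t k)⁻¹ * ((deriv (D.aDelta Δ) (D.z k)) ^ 2)⁻¹, 0]
  else
    !![0, D.gam y t k * (D.aDelta Δ (D.z k)) ^ 2; 0, 0]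

/-- The residue matrix at `z̄_k`: `σ₂ conj(τ_k) σ₂` (note `σ₂⁻¹ = σ₂`). -/
noncomputable def tauHat [Fintype ι] (D : DiscreteData ι) (Δ : Set ι) (y t : ℝ) (k : ι) :
    Matrix (Fin 2) (Fin 2) ℂ :=
  sigma2 * (D.tau Δ y t k).map (starRingEnd ℂ) * sigma2

/-- `m` has (at most) a simple pole at `p`, and `Res_{z = p} m = lim_{z → p} m(z) N`. -/
def HasResidueRelation (m : ℂ → Matrix (Fin 2) (Fin 2) ℂ) (p : ℂ)
    (N : Matrix (Fin 2) (Fin 2) ℂ) : Prop :=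
  ∃ R : Matrix (Fin 2) (Fin 2) ℂ,
    Tendsto (fun w => (w - p) • m w) (𝓝[≠] p) (𝓝 R) ∧
    Tendsto (fun w => m w * N) (𝓝[≠] p) (𝓝 R)

/-- `m = m^Δ(· ; y, t | D)` solves the discrete Riemann-Hilbert problem renormalized by `Δ`.
The values of `m` at the poles are irrelevant. -/
structure IsSolution [Fintype ι] (D : DiscreteData ι) (Δ : Set ι) (y t : ℝ)
    (m : ℂ → Matrix (Fin 2) (Fin 2) ℂ) : Prop where
  analytic : ∀ i j, DifferentiableOn ℂ (fun z => m z i j) D.polesᶜ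
  symm_conj : ∀ z ∉ D.poles,
    m z = sigma2 * (m ((starRingEnd ℂ) z)).map (starRingEnd ℂ) * sigma2
  symm_neg_conj : ∀ z ∉ D.poles,
    m z = (m (-(starRingEnd ℂ) z)).map (starRingEnd ℂ)
  normalized : ∀ i j,
    (fun z : ℂ => m z i j - (1 : Matrix (Fin 2) (Fin 2) ℂ) i j)
      =O[Bornology.cobounded ℂ] (fun z : ℂ => z⁻¹)
  residue : ∀ k, HasResidueRelation m (D.z k) (D.tau Δ y t k)
  residue_conj : ∀ k,
    HasResidueRelation m ((starRingEnd ℂ) (D.z k)) (D.tauHat Δ y t k)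

/-- Unique solvability (as a function off the poles) of the renormalized problem. -/
def UniquelySolvable [Fintype ι] (D : DiscreteData ι) (Δ : Set ι) (y t : ℝ) : Prop :=
  (∃ m, D.IsSolution Δ y t m) ∧
  ∀ m m', D.IsSolution Δ y t m → D.IsSolution Δ y t m' → ∀ z ∉ D.poles, m z = m' z

/-- `z₀ = √(-1 / (4 ξ))` with `ξ = y / t` (used for `ξ < 0`). -/
noncomputable def zZero (y t : ℝ) : ℝ :=
  Real.sqrt (-1 / (4 * (y / t)))

/-- The index set `Δ⁻_{z₀,η}` with `η = sgn t`: the `k` with `|z_k| > z₀` if `t > 0`, and those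
with `|z_k| < z₀` if `t < 0`. -/
def deltaMinus (D : DiscreteData ι) (y t : ℝ) : Set ι :=
  {k | (0 < t ∧ zZero y t < ‖D.z k‖) ∨ (t < 0 ∧ ‖D.z k‖ < zZero y t)}

/-- The space-time cone `C(y₁, y₂, v₁, v₂)` of points `(y, t)`. -/
def cone (y₁ y₂ v₁ v₂ : ℝ) : Set (ℝ × ℝ) :=
  {p | ∃ y₀ ∈ Set.Icc y₁ y₂, ∃ v ∈ Set.Icc v₁ v₂, p.1 = y₀ + v * p.2}

/-- The open annulus `I = {z : -1/(4 v₁) < |z|² < -1/(4 v₂)}`. -/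
def annulus (v₁ v₂ : ℝ) : Set ℂ :=
  {z | -1 / (4 * v₁) < ‖z‖ ^ 2 ∧ ‖z‖ ^ 2 < -1 / (4 * v₂)}

/-- The closed annulus. For `v₁ < v₂` it has the same distance function as `I`; it is also
meaningful (a circle) for `v₁ = v₂`. -/
def closedAnnulus (v₁ v₂ : ℝ) : Set ℂ :=
  {z | -1 / (4 * v₁) ≤ ‖z‖ ^ 2 ∧ ‖z‖ ^ 2 ≤ -1 / (4 * v₂)}

/-- The localized data `D(I)`: only the poles in `I` are kept, with the norming constants
`c_k(I) = c_k ∏_{n ∈ Δ, z_n ∉ I} ((z_k - z_n) / (z_k - z̄_n))²`. -/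
noncomputable def localized [Fintype ι] (D : DiscreteData ι) (Δ : Set ι) (I : Set ℂ) :
    DiscreteData {k : ι // D.z k ∈ I} where
  z := fun k => D.z k
  c := fun k => D.c k * (D.aDelta {n | n ∈ Δ ∧ D.z n ∉ I} (D.z k)) ^ 2

noncomputable instance instFintypeInside [Fintype ι] (D : DiscreteData ι) (I : Set ℂ) :
    Fintype {k : ι // D.z k ∈ I} :=
  Fintype.ofFinite _

/-- The indices of the poles that do not lie in `I`. -/
noncomputable def outside [Fintype ι] (D : DiscreteData ι) (I : Set ℂ) : Finset ι :=
  open Classical in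
  Finset.univ.filter (fun k => D.z k ∉ I)

/-- `Im(z_k) (-v₂) / |z_k|² (|z_k| + 1 / (2 √(-v₁))) dist(z_k, I)`. -/
noncomputable def rate (D : DiscreteData ι) (v₁ v₂ : ℝ) (k : ι) : ℝ :=
  (D.z k).im * (-v₂ / ‖D.z k‖ ^ 2) * (‖D.z k‖ + 1 / (2 * Real.sqrt (-v₁))) *
    Metric.infDist (D.z k) (closedAnnulus v₁ v₂)

/-- `μ(I)`, the minimum of the rates over the poles that do not lie in `I`. -/
noncomputable def mu [Fintype ι] (D : DiscreteData ι) (v₁ v₂ : ℝ)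
    (h : (D.outside (annulus v₁ v₂)).Nonempty) : ℝ :=
  (D.outside (annulus v₁ v₂)).inf' h (D.rate v₁ v₂)

end DiscreteData

open scoped ComplexConjugate

/-! Move the second-column pole of index `k` to a single node `p k`: `z_k` if `k ∉ Δ`, its conjugate
if `k ∈ Δ`. By the residue conditions and Liouville, each row of a solution is a pair of partial
fractions `(r₁, r₂)`, with `r₂` having poles at the nodes and `r₁` at their conjugates, whose
residues satisfy the finite linear system `IsRowSolution` with coefficients `a k`.

The engine is `IsRowSolution.mul_conj_add_mul_conj`. Pairing a row with the Schwarz reflection of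
another gives a rational function whose residues are proportional to the differences of the two
coefficient families. For equal coefficients the pairing is constant, so on the real line `|r₁|² +
|r₂|²` equals its value at infinity. Since residues are controlled by finitely many real samples,
the homogeneous system has only the zero solution (hence unique solvability), and the residues are
bounded by a constant depending on the nodes alone, however large the coefficients are
(`IsRowSolution.residues_le`).

The norming constants `c_k(I)` are exactly such that localization leaves the coefficients at
retained nodes unchanged (`DiscreteData.coef_localized`). Thus the localized problem is the full one
with the discarded coefficients set to zero, and the pairing exhibits `m m_I⁻¹ - 1` as a sum over
discarded nodes of coefficient times bounded quantities (`IsRowSolution.exists_norm_mismatch_le`).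
Finally `Δ⁻` is chosen so that every coefficient carries a nongrowing exponential, and in the cone
the discarded ones are `O(e^{-2μ|t|})` by `DiscreteData.rate_le`. -/

/-- The rational function with value `A` at infinity and simple poles `q j` of residue `u j`. -/
noncomputable def simplePoles {ι : Type*} [Fintype ι] (q : ι → ℂ) (A : ℂ) (u : ι → ℂ) (z : ℂ) : ℂ :=
  A + ∑ j, u j / (z - q j)

/-! ### Partial fractions: products, and residues recovered from real values. -/

section SimplePoles

variable {ι : Type*} [Fintype ι]

theorem conj_simplePoles (q : ι → ℂ) (A : ℂ) (u : ι → ℂ) (z : ℂ) :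
    conj (simplePoles q A u z) =
      simplePoles (fun j => conj (q j)) (conj A) (fun j => conj (u j)) (conj z) := by
  simp [simplePoles, map_sum]

theorem simplePoles_add (q : ι → ℂ) (A A' : ℂ) (u u' : ι → ℂ) (z : ℂ) :
    simplePoles q (A + A') (u + u') z = simplePoles q A u z + simplePoles q A' u' z := by
  simp only [simplePoles, Pi.add_apply, add_div, Finset.sum_add_distrib]
  ring

theorem simplePoles_sub (q : ι → ℂ) (A A' : ℂ) (u u' : ι → ℂ) (z : ℂ) :
    simplePoles q (A - A') (u - u') z = simplePoles q A u z - simplePoles q A' u' z := by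
  simp only [simplePoles, Pi.sub_apply, sub_div, Finset.sum_sub_distrib]
  ring

theorem simplePoles_smul (q : ι → ℂ) (c A : ℂ) (u : ι → ℂ) (z : ℂ) :
    simplePoles q (c * A) (c • u) z = c * simplePoles q A u z := by
  simp only [simplePoles, Pi.smul_apply, smul_eq_mul, mul_add, Finset.mul_sum, mul_div_assoc]

/-- The pole sets are disjoint, so the product again has simple poles, and each residue is the
residue of one factor times the value of the other. -/
theorem simplePoles_mul (q q' : ι → ℂ) (h : ∀ j k, q j ≠ q' k) (A A' : ℂ) (u u' : ι → ℂ)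
    {z : ℂ} (hz : ∀ k, z ≠ q k) (hz' : ∀ k, z ≠ q' k) :
    simplePoles q A u z * simplePoles q' A' u' z =
      A * A' + ∑ k, u k * simplePoles q' A' u' (q k) / (z - q k) +
        ∑ k, u' k * simplePoles q A u (q' k) / (z - q' k) := by
  have e1 : ∑ k, u k * simplePoles q' A' u' (q k) / (z - q k) =
      (∑ k, u k / (z - q k)) * A' +
        ∑ k, ∑ j, u k * u' j / ((q k - q' j) * (z - q k)) := by
    rw [Finset.sum_mul, ← Finset.sum_add_distrib]
    refine Finset.sum_congr rfl fun k _ => ?_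
    have h1 := sub_ne_zero.2 (hz k)
    simp only [simplePoles, mul_add, add_div, Finset.mul_sum, Finset.sum_div]
    congr 1
    · ring
    · refine Finset.sum_congr rfl fun j _ => ?_
      have h2 := sub_ne_zero.2 (h k j)
      field_simp
  have e2 : ∑ k, u' k * simplePoles q A u (q' k) / (z - q' k) =
      A * (∑ k, u' k / (z - q' k)) +
        ∑ k, ∑ j, u k * u' j / ((q' j - q k) * (z - q' j)) := by
    rw [Finset.sum_comm, Finset.mul_sum, ← Finset.sum_add_distrib]
    refine Finset.sum_congr rfl fun k _ => ?_
    have h1 := sub_ne_zero.2 (hz' k)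
    simp only [simplePoles, mul_add, add_div, Finset.mul_sum, Finset.sum_div]
    congr 1
    · ring
    · refine Finset.sum_congr rfl fun j _ => ?_
      have h2 := sub_ne_zero.2 (h j k).symm
      field_simp
  have e3 : (∑ k, u k / (z - q k)) * (∑ k, u' k / (z - q' k)) =
      (∑ k, ∑ j, u k * u' j / ((q k - q' j) * (z - q k))) +
        ∑ k, ∑ j, u k * u' j / ((q' j - q k) * (z - q' j)) := by
    rw [Finset.sum_mul_sum, ← Finset.sum_add_distrib]
    refine Finset.sum_congr rfl fun k _ => ?_
    rw [← Finset.sum_add_distrib]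
    refine Finset.sum_congr rfl fun j _ => ?_
    have h1 := sub_ne_zero.2 (hz k)
    have h2 := sub_ne_zero.2 (hz' j)
    have h3 := sub_ne_zero.2 (h k j)
    have h4 : q' j - q k = -(q k - q' j) := by ring
    rw [h4]
    field_simp
    ring
  rw [e1, e2]
  simp only [simplePoles]
  linear_combination e3

theorem norm_simplePoles_le (q : ι → ℂ) (A : ℂ) (u : ι → ℂ) {z : ℂ} {K : ℝ} (hK : ∀ j, ‖u j‖ ≤ K) :
    ‖simplePoles q A u z‖ ≤ ‖A‖ + K * ∑ j, 1 / ‖z - q j‖ := by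
  refine (norm_add_le _ _).trans (add_le_add_right ((norm_sum_le _ _).trans ?_) _)
  rw [Finset.mul_sum]
  refine Finset.sum_le_sum fun j _ => ?_
  rw [norm_div, mul_one_div]
  gcongr
  exact hK j

theorem differentiableAt_simplePoles (q : ι → ℂ) (A : ℂ) (u : ι → ℂ) {z : ℂ} (hz : ∀ k, z ≠ q k) :
    DifferentiableAt ℂ (simplePoles q A u) z := by
  unfold simplePoles
  refine (differentiableAt_const _).add (DifferentiableAt.fun_sum fun j _ => ?_)
  exact (differentiableAt_const _).div (differentiableAt_id.sub_const _) (sub_ne_zero.2 (hz j))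

theorem tendsto_sub_mul_simplePoles (q : ι → ℂ) (hq : Function.Injective q) (A : ℂ) (u : ι → ℂ)
    (k : ι) :
    Tendsto (fun w => (w - q k) * simplePoles q A u w) (𝓝[≠] (q k)) (𝓝 (u k)) := by
  classical
  -- The continuous extension of the product to the pole, with the singular term cancelled.
  set g : ℂ → ℂ := fun w => (w - q k) * (A + ∑ j ∈ Finset.univ.erase k, u j / (w - q j)) + u k
  have hg : ContinuousAt g (q k) := by
    refine ((continuousAt_id.sub continuousAt_const).mul (continuousAt_const.add
      (tendsto_finsetSum _ fun j hj => ?_))).add continuousAt_const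
    exact ContinuousAt.div continuousAt_const (continuousAt_id.sub continuousAt_const)
      (sub_ne_zero.2 fun h => Finset.ne_of_mem_erase hj (hq h).symm)
  have hgk : g (q k) = u k := by simp [g]
  have := hg.tendsto.mono_left (nhdsWithin_le_nhds (s := {q k}ᶜ))
  rw [hgk] at this
  refine this.congr' ?_
  filter_upwards [self_mem_nhdsWithin] with w hw
  have hw' : w - q k ≠ 0 := sub_ne_zero.2 hw
  simp only [g, simplePoles, ← Finset.add_sum_erase Finset.univ (fun j => u j / (w - q j))
    (Finset.mem_univ k)]
  field_simp
  ring

/-- Clearing denominators gives a polynomial of degree below the number of poles with too many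
zeros. It vanishes, and its value at `q k` is a nonzero multiple of `u k`. -/
theorem eq_zero_of_sum_div_eq_zero (q : ι → ℂ) (hq : Function.Injective q)
    {κ : Type*} [Fintype κ] (x : κ → ℂ) (hx : Function.Injective x) (hqx : ∀ i j, x i ≠ q j)
    (hcard : Fintype.card ι < Fintype.card κ) (u : ι → ℂ)
    (h : ∀ i, ∑ j, u j / (x i - q j) = 0) : u = 0 := by
  classical
  open Polynomial in
  let P : ℂ[X] := ∑ k, C (u k) * ∏ j ∈ Finset.univ.erase k, (X - C (q j))
  have hP : P = 0 := by
    refine Polynomial.eq_zero_of_natDegree_lt_card_of_eval_eq_zero P hx (fun i => ?_)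
      (lt_of_le_of_lt ?_ hcard)
    · have : P.eval (x i) = (∏ j, (x i - q j)) * ∑ j, u j / (x i - q j) := by
        simp only [P, Polynomial.eval_finsetSum, Polynomial.eval_mul, Polynomial.eval_C,
          Polynomial.eval_prod, Polynomial.eval_sub, Polynomial.eval_X, Finset.mul_sum]
        refine Finset.sum_congr rfl fun k _ => ?_
        rw [← Finset.mul_prod_erase Finset.univ (fun j => x i - q j) (Finset.mem_univ k)]
        have := sub_ne_zero.2 (hqx i k)
        field_simp
      rw [this, h i, mul_zero]
    · refine Polynomial.natDegree_sum_le_of_forall_le _ _ fun k _ => ?_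
      refine (Polynomial.natDegree_C_mul_le _ _).trans ?_
      refine (Polynomial.natDegree_prod_le _ _).trans ?_
      simp
  funext k
  have h1 : P.eval (q k) = u k * ∏ j ∈ Finset.univ.erase k, (q k - q j) := by
    simp only [P, Polynomial.eval_finsetSum, Polynomial.eval_mul, Polynomial.eval_C,
      Polynomial.eval_prod, Polynomial.eval_sub, Polynomial.eval_X]
    rw [Finset.sum_eq_single k _ (by simp)]
    intro b _ hb
    rw [Finset.prod_eq_zero (Finset.mem_erase.2 ⟨hb.symm, Finset.mem_univ k⟩) (sub_self _),
      mul_zero]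
  rw [hP, Polynomial.eval_zero] at h1
  refine (mul_eq_zero.1 h1.symm).resolve_right (Finset.prod_ne_zero_iff.2 fun j hj => ?_)
  exact sub_ne_zero.2 fun h => Finset.ne_of_mem_erase hj (hq h).symm

/-- Sampling at more real points than there are poles is an injective linear map on residues, hence
bounded below in finite dimension. The constant depends only on the poles. -/
theorem exists_norm_residue_le (q : ι → ℂ) (hq : Function.Injective q) (him : ∀ k, (q k).im ≠ 0) :
    ∃ K : ℝ, 0 ≤ K ∧ ∀ (A : ℂ) (u : ι → ℂ), ‖A‖ ≤ 1 →
      (∀ x : ℝ, ‖simplePoles q A u x‖ ≤ 1) → ∀ k, ‖u k‖ ≤ K := by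
  let x : Fin (Fintype.card ι + 1) → ℂ := fun i => ((i : ℕ) : ℝ)
  have hx : Function.Injective x := fun i j hij => by
    simpa [x, Fin.val_inj] using hij
  have hxq : ∀ i j, x i ≠ q j := fun i j h => him j (by rw [← h]; simp [x])
  let L : (ι → ℂ) →ₗ[ℂ] (Fin (Fintype.card ι + 1) → ℂ) :=
    { toFun := fun u i => ∑ j, u j / (x i - q j)
      map_add' := fun u v => by
        funext i; simp [add_div, Finset.sum_add_distrib]
      map_smul' := fun c u => by
        funext i; simp [mul_div_assoc, Finset.mul_sum] }
  have hL : LinearMap.ker L = ⊥ := by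
    rw [LinearMap.ker_eq_bot']
    intro u hu
    exact eq_zero_of_sum_div_eq_zero q hq x hx hxq (by simp) u fun i => congrFun hu i
  obtain ⟨K, -, hK⟩ := L.exists_antilipschitzWith hL
  -- The factor 2 bounds a sample minus the value `A` at infinity, each of norm at most 1.
  refine ⟨K * 2, by positivity, fun A u hA h k => ?_⟩
  have h1 : ‖u‖ ≤ K * ‖L u‖ := by
    have := hK.le_mul_dist u 0
    simpa [dist_eq_norm] using this
  refine (norm_le_pi_norm u k).trans (h1.trans (mul_le_mul_of_nonneg_left ?_ K.coe_nonneg))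
  refine (pi_norm_le_iff_of_nonneg (by norm_num)).2 fun i => ?_
  have h2 : L u i = simplePoles q A u ((i : ℕ) : ℝ) - A := by
    simp [L, simplePoles, x]
  rw [h2]
  refine (norm_sub_le _ _).trans ?_
  linarith [h ((i : ℕ) : ℝ)]

end SimplePoles

theorem simplePoles_reflect {ι : Type*} [Fintype ι] {q : ι → ℂ} (σ : ι ≃ ι)
    (hσ : ∀ k, q (σ k) = -conj (q k)) (A : ℂ) (u : ι → ℂ) (z : ℂ) :
    simplePoles q (conj A) (fun k => -conj (u (σ k))) z = conj (simplePoles q A u (-conj z)) := by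
  simp only [simplePoles, map_add, map_sum]
  congr 1
  refine Eq.trans (Finset.sum_congr rfl fun k _ => ?_) (Equiv.sum_comp σ _)
  rw [hσ, map_div₀, map_sub, map_neg, map_neg, Complex.conj_conj, Complex.conj_conj, neg_div,
    ← div_neg]
  congr 1
  ring

/-! ### Rows of a solution as a finite linear system. -/

/-- `(u, w)` are the residues of a row `(r₁, r₂)` with value `(A, B)` at infinity, where `r₂` has
poles at the nodes `p k` with residue `a k * r₁ (p k)` and `r₁` has poles at the conjugate nodes
with residue `- conj (a k) * r₂ (conj (p k))`. -/
structure IsRowSolution {ι : Type*} [Fintype ι] (p a : ι → ℂ) (A B : ℂ) (u w : ι → ℂ) : Prop where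
  right : ∀ k, w k = a k * simplePoles (fun j => conj (p j)) A u (p k)
  left : ∀ k, u k = -conj (a k) * simplePoles p B w (conj (p k))

namespace IsRowSolution

variable {ι : Type*} [Fintype ι] {p a b : ι → ℂ} {A B A' B' : ℂ} {u w u' w' : ι → ℂ}

/-- This is an entry of `M(z) M'(conj z)ᴴ`. At each node the residue conditions of both rows produce
the same product of values, once with `a k` and once with `-b k`, so only the difference of
coefficients survives. -/
theorem mul_conj_add_mul_conj (hp : ∀ j k, p j ≠ conj (p k)) (hr : IsRowSolution p a A B u w)
    (hs : IsRowSolution p b A' B' u' w') {z : ℂ} (hz : ∀ k, z ≠ p k)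
    (hz' : ∀ k, z ≠ conj (p k)) :
    simplePoles (fun j => conj (p j)) A u z *
        conj (simplePoles (fun j => conj (p j)) A' u' (conj z)) +
      simplePoles p B w z * conj (simplePoles p B' w' (conj z)) =
    A * conj A' + B * conj B' +
      (∑ k, (a k - b k) * simplePoles (fun j => conj (p j)) A u (p k) *
        conj (simplePoles p B' w' (conj (p k))) / (z - p k) +
      ∑ k, conj (b k - a k) * simplePoles p B w (conj (p k)) *
        conj (simplePoles (fun j => conj (p j)) A' u' (p k)) / (z - conj (p k))) := by
  have e1 := simplePoles_mul (fun j => conj (p j)) p (fun j k => (hp k j).symm) A (conj A') u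
    (fun j => conj (u' j)) hz' hz
  have e2 := simplePoles_mul p (fun j => conj (p j)) hp B (conj B') w
    (fun j => conj (w' j)) hz hz'
  have e3 := conj_simplePoles (fun j => conj (p j)) A' u' (conj z)
  have e4 := conj_simplePoles p B' w' (conj z)
  simp only [Complex.conj_conj] at e3 e4
  rw [e3, e4, e1, e2]
  have e5 : ∑ k, u k * simplePoles p (conj A') (fun j => conj (u' j)) (conj (p k)) /
        (z - conj (p k)) +
      ∑ k, conj (w' k) * simplePoles p B w (conj (p k)) / (z - conj (p k)) =
      ∑ k, conj (b k - a k) * simplePoles p B w (conj (p k)) *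
        conj (simplePoles (fun j => conj (p j)) A' u' (p k)) / (z - conj (p k)) := by
    rw [← Finset.sum_add_distrib]
    refine Finset.sum_congr rfl fun k _ => ?_
    rw [conj_simplePoles (fun j => conj (p j))]
    simp only [Complex.conj_conj]
    rw [hr.left k, hs.right k, map_mul, conj_simplePoles, map_sub]
    simp only [Complex.conj_conj]
    ring
  have e6 : ∑ k, conj (u' k) * simplePoles (fun j => conj (p j)) A u (p k) / (z - p k) +
      ∑ k, w k * simplePoles (fun j => conj (p j)) (conj B') (fun j => conj (w' j)) (p k) /
        (z - p k) =
      ∑ k, (a k - b k) * simplePoles (fun j => conj (p j)) A u (p k) *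
        conj (simplePoles p B' w' (conj (p k))) / (z - p k) := by
    rw [← Finset.sum_add_distrib]
    refine Finset.sum_congr rfl fun k _ => ?_
    rw [conj_simplePoles p]
    simp only [Complex.conj_conj]
    rw [hr.right k, hs.left k, map_mul, conj_simplePoles p]
    simp only [Complex.conj_conj, map_neg]
    ring
  rw [← e5, ← e6]
  ring

/-- Pair the row with itself at a real point: conjugation fixes the point and all residues cancel.
-/
theorem normSq_add_normSq (hp : ∀ j k, p j ≠ conj (p k)) (hr : IsRowSolution p a A B u w) (x : ℝ) :
    ‖simplePoles (fun j => conj (p j)) A u x‖ ^ 2 + ‖simplePoles p B w x‖ ^ 2 =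
      ‖A‖ ^ 2 + ‖B‖ ^ 2 := by
  have h1 : ∀ k, (x : ℂ) ≠ p k := fun k h => hp k k (by rw [← h, Complex.conj_ofReal])
  have h2 : ∀ k, (x : ℂ) ≠ conj (p k) := fun k h => h1 k (by
    rw [← Complex.conj_conj (p k), ← h, Complex.conj_ofReal])
  have := hr.mul_conj_add_mul_conj hp hr h1 h2
  simp only [sub_self, zero_mul, map_zero, zero_div, Finset.sum_const_zero, add_zero,
    Complex.conj_ofReal, Complex.mul_conj'] at this
  exact_mod_cast this

/-- The bound on the real line does not involve `a`, so the residue bound is uniform over all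
coefficients; this is what makes the asymptotics uniform in space and time. -/
theorem residues_le (hp : ∀ j k, p j ≠ conj (p k)) (hinj : Function.Injective p) :
    ∃ K : ℝ, 0 ≤ K ∧ ∀ (a : ι → ℂ) (A B : ℂ) (u w : ι → ℂ), IsRowSolution p a A B u w →
      ‖A‖ ^ 2 + ‖B‖ ^ 2 ≤ 1 → ∀ k, ‖u k‖ ≤ K ∧ ‖w k‖ ≤ K := by
  have him : ∀ k, (p k).im ≠ 0 := fun k h => hp k k (Complex.conj_eq_iff_im.2 h).symm
  obtain ⟨K₁, h₁, H₁⟩ := exists_norm_residue_le (fun j => conj (p j))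
    (fun i j h => hinj ((starRingEnd ℂ).injective h)) (by simpa using him)
  obtain ⟨K₂, h₂, H₂⟩ := exists_norm_residue_le p hinj him
  refine ⟨max K₁ K₂, le_max_of_le_left h₁, fun a A B u w hr hAB k => ?_⟩
  refine ⟨(H₁ A u ?_ (fun x => ?_) k).trans (le_max_left _ _),
    (H₂ B w ?_ (fun x => ?_) k).trans (le_max_right _ _)⟩
  · exact abs_le_one_iff_mul_self_le_one.2 (by nlinarith [sq_nonneg ‖B‖]) |> le_of_abs_le
  · have := hr.normSq_add_normSq hp x
    exact abs_le_one_iff_mul_self_le_one.2 (by nlinarith [sq_nonneg ‖simplePoles p B w x‖])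
      |> le_of_abs_le
  · exact abs_le_one_iff_mul_self_le_one.2 (by nlinarith [sq_nonneg ‖A‖]) |> le_of_abs_le
  · have := hr.normSq_add_normSq hp x
    exact abs_le_one_iff_mul_self_le_one.2 (by
      nlinarith [sq_nonneg ‖simplePoles (fun j => conj (p j)) A u x‖]) |> le_of_abs_le

theorem sub (hr : IsRowSolution p a A B u w) (hs : IsRowSolution p a A' B' u' w') :
    IsRowSolution p a (A - A') (B - B') (u - u') (w - w') where
  right k := by rw [simplePoles_sub, Pi.sub_apply, hr.right k, hs.right k]; ring
  left k := by rw [simplePoles_sub, Pi.sub_apply, hr.left k, hs.left k]; ring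

theorem eq_zero (hp : ∀ j k, p j ≠ conj (p k)) (hinj : Function.Injective p)
    (hr : IsRowSolution p a 0 0 u w) : u = 0 ∧ w = 0 := by
  have him : ∀ k, (p k).im ≠ 0 := fun k h => hp k k (Complex.conj_eq_iff_im.2 h).symm
  let x : Fin (Fintype.card ι + 1) → ℂ := fun i => ((i : ℕ) : ℝ)
  have hx : Function.Injective x := fun i j hij => by simpa [x, Fin.val_inj] using hij
  have h0 := fun i : Fin (Fintype.card ι + 1) => hr.normSq_add_normSq hp ((i : ℕ) : ℝ)
  constructor
  · refine eq_zero_of_sum_div_eq_zero (fun j => conj (p j))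
      (fun i j h => hinj ((starRingEnd ℂ).injective h)) x hx
      (fun i j h => him j (by simpa [x] using (congrArg Complex.im h).symm)) (by simp) u fun i => ?_
    have : ‖simplePoles (fun j => conj (p j)) 0 u ((i : ℕ) : ℝ)‖ ^ 2 = 0 := by
      have := h0 i
      simp only [norm_zero] at this
      nlinarith [sq_nonneg ‖simplePoles (fun j => conj (p j)) 0 u ((i : ℕ) : ℝ)‖,
        sq_nonneg ‖simplePoles p 0 w ((i : ℕ) : ℝ)‖]
    simpa [simplePoles, x] using this
  · refine eq_zero_of_sum_div_eq_zero p hinj x hx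
      (fun i j h => him j (by simpa [x] using (congrArg Complex.im h).symm)) (by simp) w fun i => ?_
    have : ‖simplePoles p 0 w ((i : ℕ) : ℝ)‖ ^ 2 = 0 := by
      have := h0 i
      simp only [norm_zero] at this
      nlinarith [sq_nonneg ‖simplePoles (fun j => conj (p j)) 0 u ((i : ℕ) : ℝ)‖,
        sq_nonneg ‖simplePoles p 0 w ((i : ℕ) : ℝ)‖]
    simpa [simplePoles, x] using this

theorem unique (hp : ∀ j k, p j ≠ conj (p k)) (hinj : Function.Injective p)
    (hr : IsRowSolution p a A B u w) (hs : IsRowSolution p a A B u' w') : u = u' ∧ w = w' := by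
  have h := hr.sub hs
  rw [sub_self, sub_self] at h
  obtain ⟨h1, h2⟩ := h.eq_zero hp hinj
  exact ⟨sub_eq_zero.1 h1, sub_eq_zero.1 h2⟩

/-- The system is square and its homogeneous version is injective by `eq_zero`, hence it is
surjective; the values at infinity supply the right-hand side. -/
theorem exists_solution (hp : ∀ j k, p j ≠ conj (p k)) (hinj : Function.Injective p) (A B : ℂ) :
    ∃ u w, IsRowSolution p a A B u w := by
  let L : ((ι → ℂ) × (ι → ℂ)) →ₗ[ℂ] ((ι → ℂ) × (ι → ℂ)) :=
    { toFun := fun v =>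
        (fun k => v.1 k + conj (a k) * simplePoles p 0 v.2 (conj (p k)),
          fun k => v.2 k - a k * simplePoles (fun j => conj (p j)) 0 v.1 (p k))
      map_add' := fun v v' => by
        have h1 := fun z => simplePoles_add p 0 0 v.2 v'.2 z
        have h2 := fun z => simplePoles_add (fun j => conj (p j)) 0 0 v.1 v'.1 z
        simp only [add_zero] at h1 h2
        ext k
        · simp only [Prod.fst_add, Prod.snd_add, Pi.add_apply, h1]; ring
        · simp only [Prod.fst_add, Prod.snd_add, Pi.add_apply, h2]; ring
      map_smul' := fun c v => by
        have h1 := fun z => simplePoles_smul p c 0 v.2 z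
        have h2 := fun z => simplePoles_smul (fun j => conj (p j)) c 0 v.1 z
        simp only [mul_zero] at h1 h2
        ext k
        · simp only [Prod.smul_fst, Prod.smul_snd, Pi.smul_apply, h1, smul_eq_mul,
            RingHom.id_apply]; ring
        · simp only [Prod.smul_fst, Prod.smul_snd, Pi.smul_apply, h2, smul_eq_mul,
            RingHom.id_apply]; ring }
  have hL : Function.Injective L := by
    rw [← LinearMap.ker_eq_bot, LinearMap.ker_eq_bot']
    rintro ⟨u, w⟩ h
    have hr : IsRowSolution p a 0 0 u w := by
      constructor
      · intro k
        exact sub_eq_zero.1 (congrFun (congrArg Prod.snd h) k)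
      · intro k
        rw [neg_mul]
        exact eq_neg_of_add_eq_zero_left (congrFun (congrArg Prod.fst h) k)
    obtain ⟨h1, h2⟩ := hr.eq_zero hp hinj
    simp [h1, h2]
  obtain ⟨⟨u, w⟩, h⟩ := LinearMap.injective_iff_surjective.1 hL
    (fun k => -conj (a k) * B, fun k => a k * A)
  refine ⟨u, w, fun k => ?_, fun k => ?_⟩
  · have := congrFun (congrArg Prod.snd h) k
    simp only [L, LinearMap.coe_mk, AddHom.coe_mk, simplePoles, zero_add] at this
    simp only [simplePoles]
    linear_combination this
  · have := congrFun (congrArg Prod.fst h) k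
    simp only [L, LinearMap.coe_mk, AddHom.coe_mk, simplePoles, zero_add] at this
    simp only [simplePoles]
    linear_combination this

/-- Produces the second row of a `σ₂`-symmetric matrix from the first. -/
theorem conj_swap (hr : IsRowSolution p a A B u w) :
    IsRowSolution p a (-conj B) (conj A) (fun k => -conj (w k)) (fun k => conj (u k)) := by
  have h1 := fun z => conj_simplePoles p B w (conj z)
  have h2 := fun z => conj_simplePoles (fun j => conj (p j)) A u (conj z)
  simp only [Complex.conj_conj] at h1 h2
  have h3 := fun z => simplePoles_smul (fun j => conj (p j)) (-1) (conj B) (fun k => conj (w k)) z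
  constructor
  · intro k
    have : (fun k => -conj (w k)) = (-1 : ℂ) • fun k => conj (w k) := by
      funext k; simp
    rw [this, ← neg_one_mul (conj B), h3, ← h1, hr.left k]
    simp
  · intro k
    rw [← h2, hr.right k]
    simp

/-- The row counterpart of the symmetry `m(z) = conj (m(-conj z))`; with uniqueness it shows that a
row with real values at infinity has this symmetry. -/
theorem reflect (σ : ι ≃ ι) (hσ : ∀ k, p (σ k) = -conj (p k)) (ha : ∀ k, a (σ k) = -conj (a k))
    (hr : IsRowSolution p a A B u w) :
    IsRowSolution p a (conj A) (conj B) (fun k => -conj (u (σ k)))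
      (fun k => -conj (w (σ k))) := by
  have h1 := simplePoles_reflect σ hσ B w
  have h2 := simplePoles_reflect (q := fun j => conj (p j)) σ (fun k => by simp [hσ]) A u
  constructor
  · intro k
    rw [h2, ← hσ k, hr.right (σ k), ha]
    simp
  · intro k
    rw [h1, Complex.conj_conj, hr.left (σ k), ha, hσ]
    simp

end IsRowSolution

/-! ### From residue relations to partial fractions by Liouville. -/

theorem simplePoles_sub_isBigO {κ : Type*} [Fintype κ] (q : κ → ℂ) (A : ℂ) (u : κ → ℂ) :
    (fun z => simplePoles q A u z - A) =O[Bornology.cobounded ℂ] (fun z : ℂ => z⁻¹) := by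
  simp only [simplePoles, add_sub_cancel_left]
  refine Asymptotics.IsBigO.fun_sum fun j _ => ?_
  refine Asymptotics.IsBigO.of_bound (2 * ‖u j‖) ?_
  filter_upwards [(hasBasis_cobounded_norm (E := ℂ)).mem_of_mem (i := 2 * ‖q j‖ + 1) trivial]
    with z hz
  have hz : 2 * ‖q j‖ + 1 ≤ ‖z‖ := hz
  have h1 : ‖z‖ / 2 ≤ ‖z - q j‖ := by
    have := norm_sub_norm_le z (q j)
    linarith [norm_nonneg (q j)]
  have h0 : 0 < ‖z‖ := by linarith [norm_nonneg (q j)]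
  rw [norm_div, norm_inv]
  calc ‖u j‖ / ‖z - q j‖ ≤ ‖u j‖ / (‖z‖ / 2) := by gcongr
    _ = 2 * ‖u j‖ * ‖z‖⁻¹ := by field_simp

/-- A function that is holomorphic off finitely many simple poles and tends to `0` at infinity,
with all its residues zero, vanishes. -/
theorem eq_zero_of_tendsto_sub_mul_zero {S : Set ℂ} (hS : S.Finite) {g : ℂ → ℂ}
    (hd : DifferentiableOn ℂ g Sᶜ) (hres : ∀ c ∈ S, Tendsto (fun w => (w - c) * g w) (𝓝[≠] c) (𝓝 0))
    (hinf : Tendsto g (Bornology.cobounded ℂ) (𝓝 0)) : ∀ z ∉ S, g z = 0 := by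
  have hopen : IsOpen Sᶜ := hS.isClosed.isOpen_compl
  have hda : ∀ z ∉ S, DifferentiableAt ℂ g z := fun z hz => hd.differentiableAt (hopen.mem_nhds hz)
  -- Taking the punctured limit everywhere removes all singularities at once; off `S` it does not
  -- change `g`.
  let G : ℂ → ℂ := fun z => limUnder (𝓝[≠] z) g
  have hG : ∀ z ∉ S, G z = g z := fun z hz =>
    ((hda z hz).continuousAt.tendsto.mono_left nhdsWithin_le_nhds).limUnder_eq
  have hnear : ∀ c, (S \ {c})ᶜ ∈ 𝓝 c := fun c =>
    (hS.subset Set.sdiff_subset).isClosed.isOpen_compl.mem_nhds (by simp)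
  have hdiff : Differentiable ℂ G := by
    intro c
    have hlim : Tendsto (fun w => (w - c) * g w) (𝓝[≠] c) (𝓝 0) := by
      by_cases hc : c ∈ S
      · exact hres c hc
      · have : ContinuousAt (fun w => (w - c) * g w) c :=
          (continuousAt_id.sub continuousAt_const).mul (hda c hc).continuousAt
        simpa using this.tendsto.mono_left (nhdsWithin_le_nhds (s := {c}ᶜ))
    -- The growth hypothesis of Riemann's removable singularity theorem, supplied by the vanishing
    -- residue.
    have ho : (fun z => g z - g c) =o[𝓝[≠] c] fun z => (z - c)⁻¹ := by
      rw [Asymptotics.isLittleO_iff_tendsto']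
      · have h2 : Tendsto (fun w => (w - c) * g c) (𝓝[≠] c) (𝓝 0) := by
          have : ContinuousAt (fun w => (w - c) * g c) c :=
            (continuousAt_id.sub continuousAt_const).mul continuousAt_const
          simpa using this.tendsto.mono_left (nhdsWithin_le_nhds (s := {c}ᶜ))
        have := hlim.sub h2
        rw [sub_zero] at this
        refine this.congr fun w => ?_
        rw [div_inv_eq_mul]
        ring
      · filter_upwards [self_mem_nhdsWithin] with w hw h
        exact absurd (inv_eq_zero.1 h) (sub_ne_zero.2 hw)
    have hd' : DifferentiableOn ℂ g ((S \ {c})ᶜ \ {c}) := fun z hz =>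
      (hda z fun h => hz.1 ⟨h, hz.2⟩).differentiableWithinAt
    have h := (Complex.differentiableOn_update_limUnder_of_isLittleO (hnear c) hd'
      ho).differentiableAt (hnear c)
    refine h.congr_of_eventuallyEq ?_
    filter_upwards [hnear c] with z hz
    by_cases hzc : z = c
    · subst hzc; simp [G]
    · rw [Function.update_of_ne hzc]
      exact hG z fun hzS => hz ⟨hzS, hzc⟩
  have hGinf : Tendsto G (cocompact ℂ) (𝓝 0) := by
    rw [← Metric.cobounded_eq_cocompact]
    refine hinf.congr' ?_
    filter_upwards [Bornology.isBounded_def.1 hS.isBounded] with z hz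
    exact (hG z hz).symm
  intro z hz
  rw [← hG z hz]
  exact hdiff.apply_eq_of_tendsto_cocompact z hGinf

theorem eq_simplePoles {κ : Type*} [Fintype κ] (q : κ → ℂ) (hq : Function.Injective q) {f : ℂ → ℂ}
    {A : ℂ} {u : κ → ℂ} (hd : DifferentiableOn ℂ f (Set.range q)ᶜ)
    (hres : ∀ k, Tendsto (fun w => (w - q k) * f w) (𝓝[≠] (q k)) (𝓝 (u k)))
    (hinf : (fun z => f z - A) =O[Bornology.cobounded ℂ] (fun z : ℂ => z⁻¹)) :
    ∀ z ∉ Set.range q, f z = simplePoles q A u z := by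
  intro z hz
  refine sub_eq_zero.1 (eq_zero_of_tendsto_sub_mul_zero (Set.finite_range q)
    (g := fun z => f z - simplePoles q A u z) (hd.sub fun z hz => ?_) ?_ ?_ z hz)
  · exact (differentiableAt_simplePoles q A u fun k h => hz ⟨k, h.symm⟩).differentiableWithinAt
  · rintro _ ⟨k, rfl⟩
    have := (hres k).sub (tendsto_sub_mul_simplePoles q hq A u k)
    rw [sub_self] at this
    exact this.congr fun w => by ring
  · have h := (hinf.sub (simplePoles_sub_isBigO q A u)).trans_tendsto
      tendsto_inv₀_cobounded
    exact h.congr fun w => by ring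

theorem hasResidueRelation_iff {m : ℂ → Matrix (Fin 2) (Fin 2) ℂ} {p : ℂ}
    {N : Matrix (Fin 2) (Fin 2) ℂ} :
    DiscreteData.HasResidueRelation m p N ↔ ∃ R : Matrix (Fin 2) (Fin 2) ℂ, ∀ i j,
      Tendsto (fun w => (w - p) * m w i j) (𝓝[≠] p) (𝓝 (R i j)) ∧
      Tendsto (fun w => m w i 0 * N 0 j + m w i 1 * N 1 j) (𝓝[≠] p) (𝓝 (R i j)) := by
  have key : ∀ (f : ℂ → Matrix (Fin 2) (Fin 2) ℂ) (R : Matrix (Fin 2) (Fin 2) ℂ),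
      Tendsto f (𝓝[≠] p) (𝓝 R) ↔
        ∀ i j, Tendsto (fun w => f w i j) (𝓝[≠] p) (𝓝 (R i j)) := fun f R =>
    tendsto_pi_nhds.trans (forall_congr' fun i => tendsto_pi_nhds)
  simp only [DiscreteData.HasResidueRelation, key, Matrix.smul_apply, smul_eq_mul,
    Matrix.mul_apply, Fin.sum_univ_two, forall_and]

theorem hasResidueRelation_upper_iff {m : ℂ → Matrix (Fin 2) (Fin 2) ℂ} {p a : ℂ} :
    DiscreteData.HasResidueRelation m p !![0, a; 0, 0] ↔ ∀ i, ∃ ρ : ℂ,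
      Tendsto (fun w => (w - p) * m w i 0) (𝓝[≠] p) (𝓝 0) ∧
      Tendsto (fun w => (w - p) * m w i 1) (𝓝[≠] p) (𝓝 ρ) ∧
      Tendsto (fun w => a * m w i 0) (𝓝[≠] p) (𝓝 ρ) := by
  rw [hasResidueRelation_iff]
  constructor
  · rintro ⟨R, hR⟩ i
    have h0 : R i 0 = 0 := tendsto_nhds_unique (hR i 0).2 (by simp)
    refine ⟨R i 1, h0 ▸ (hR i 0).1, (hR i 1).1, ?_⟩
    simpa [mul_comm] using (hR i 1).2
  · intro h
    choose ρ h using h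
    refine ⟨fun i j => if j = 0 then 0 else ρ i, fun i j => ?_⟩
    fin_cases j
    · simpa using (h i).1
    · simpa [mul_comm] using (h i).2

theorem hasResidueRelation_lower_iff {m : ℂ → Matrix (Fin 2) (Fin 2) ℂ} {p a : ℂ} :
    DiscreteData.HasResidueRelation m p !![0, 0; a, 0] ↔ ∀ i, ∃ ρ : ℂ,
      Tendsto (fun w => (w - p) * m w i 1) (𝓝[≠] p) (𝓝 0) ∧
      Tendsto (fun w => (w - p) * m w i 0) (𝓝[≠] p) (𝓝 ρ) ∧
      Tendsto (fun w => a * m w i 1) (𝓝[≠] p) (𝓝 ρ) := by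
  rw [hasResidueRelation_iff]
  constructor
  · rintro ⟨R, hR⟩ i
    have h0 : R i 1 = 0 := tendsto_nhds_unique (hR i 1).2 (by simp)
    refine ⟨R i 0, h0 ▸ (hR i 1).1, (hR i 0).1, ?_⟩
    simpa [mul_comm] using (hR i 0).2
  · intro h
    choose ρ h using h
    refine ⟨fun i j => if j = 0 then ρ i else 0, fun i j => ?_⟩
    fin_cases j
    · simpa [mul_comm] using (h i).2
    · simpa using (h i).1

section NodeRelations

variable {ι : Type*} [Fintype ι] {p a : ι → ℂ}

theorem sum_elim_conj_injective {ι : Type*} {p : ι → ℂ} (hp : ∀ j k, p j ≠ conj (p k)) (hinj : Function.Injective p) :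
    Function.Injective (Sum.elim p fun j => conj (p j)) := by
  rintro (i | i) (j | j) h
  · exact congrArg _ (hinj h)
  · exact absurd h (hp i j)
  · exact absurd h.symm (hp j i)
  · exact congrArg _ (hinj ((starRingEnd ℂ).injective h))

/-- The nilpotent residue matrices force the first column to have zero residue at the nodes and the
second at their conjugates. Each column thus has only half of the poles, and the limits in the
residue relations become values of partial fractions. -/
theorem exists_isRowSolution_of_residues (hp : ∀ j k, p j ≠ conj (p k))
    (hinj : Function.Injective p) {m : ℂ → Matrix (Fin 2) (Fin 2) ℂ} (i : Fin 2)
    (hd : ∀ j, DifferentiableOn ℂ (fun z => m z i j) {w | ∃ k, w = p k ∨ w = conj (p k)}ᶜ)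
    (hinf : ∀ j, (fun z : ℂ => m z i j - (1 : Matrix (Fin 2) (Fin 2) ℂ) i j)
      =O[Bornology.cobounded ℂ] (fun z : ℂ => z⁻¹))
    (h : ∀ k, DiscreteData.HasResidueRelation m (p k) !![0, a k; 0, 0])
    (h' : ∀ k, DiscreteData.HasResidueRelation m (conj (p k)) !![0, 0; -conj (a k), 0]) :
    ∃ u w, IsRowSolution p a ((1 : Matrix (Fin 2) (Fin 2) ℂ) i 0)
      ((1 : Matrix (Fin 2) (Fin 2) ℂ) i 1) u w ∧
      ∀ z, (∀ k, z ≠ p k ∧ z ≠ conj (p k)) →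
        m z i 0 = simplePoles (fun j => conj (p j)) ((1 : Matrix (Fin 2) (Fin 2) ℂ) i 0) u z ∧
        m z i 1 = simplePoles p ((1 : Matrix (Fin 2) (Fin 2) ℂ) i 1) w z := by
  choose w h1 h2 h3 using fun k => hasResidueRelation_upper_iff.1 (h k) i
  choose u h1' h2' h3' using fun k => hasResidueRelation_lower_iff.1 (h' k) i
  have hrange : Set.range (Sum.elim p fun j => conj (p j)) =
      {w | ∃ k, w = p k ∨ w = conj (p k)} := by
    ext z
    simp only [Set.Sum.elim_range, Set.mem_union, Set.mem_range, Set.mem_ofPred_eq, exists_or,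
      eq_comm]
  have hnot : ∀ {z : ℂ}, (∀ k, z ≠ p k ∧ z ≠ conj (p k)) →
      z ∉ Set.range (Sum.elim p fun j => conj (p j)) := fun {z} hz => by
    rw [hrange]
    rintro ⟨k, hk | hk⟩
    · exact (hz k).1 hk
    · exact (hz k).2 hk
  have e0 : ∀ z, (∀ k, z ≠ p k ∧ z ≠ conj (p k)) →
      m z i 0 = simplePoles (fun j => conj (p j)) ((1 : Matrix (Fin 2) (Fin 2) ℂ) i 0) u z := by
    intro z hz
    rw [eq_simplePoles _ (sum_elim_conj_injective hp hinj) (u := Sum.elim 0 u)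
      (f := fun z => m z i 0) (hrange ▸ hd 0) ?_ (hinf 0) z (hnot hz)]
    · simp [simplePoles, Fintype.sum_sum_type]
    · rintro (k | k)
      · exact h1 k
      · exact h2' k
  have e1 : ∀ z, (∀ k, z ≠ p k ∧ z ≠ conj (p k)) →
      m z i 1 = simplePoles p ((1 : Matrix (Fin 2) (Fin 2) ℂ) i 1) w z := by
    intro z hz
    rw [eq_simplePoles _ (sum_elim_conj_injective hp hinj) (u := Sum.elim w 0)
      (f := fun z => m z i 1) (hrange ▸ hd 1) ?_ (hinf 1) z (hnot hz)]
    · simp [simplePoles, Fintype.sum_sum_type]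
    · rintro (k | k)
      · exact h2 k
      · exact h1' k
  have hev : ∀ c, ∀ᶠ z in 𝓝[≠] c, ∀ k, z ≠ p k ∧ z ≠ conj (p k) := fun c => by
    have hfin : (Set.range (Sum.elim p fun j => conj (p j)) \ {c}).Finite :=
      (Set.finite_range _).subset Set.sdiff_subset
    have : (Set.range (Sum.elim p fun j => conj (p j)) \ {c})ᶜ ∈ 𝓝 c :=
      hfin.isClosed.isOpen_compl.mem_nhds (by simp)
    filter_upwards [nhdsWithin_le_nhds this, self_mem_nhdsWithin] with z hz hzc k
    exact ⟨fun hk => hz ⟨⟨Sum.inl k, hk.symm⟩, hzc⟩, fun hk => hz ⟨⟨Sum.inr k, hk.symm⟩, hzc⟩⟩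
  refine ⟨u, w, ⟨fun k => ?_, fun k => ?_⟩, fun z hz => ⟨e0 z hz, e1 z hz⟩⟩
  · refine tendsto_nhds_unique (h3 k) (Tendsto.const_mul _ ?_)
    refine Tendsto.congr' ?_ ((differentiableAt_simplePoles (fun j => conj (p j)) _ u
      fun j => hp k j).continuousAt.tendsto.mono_left nhdsWithin_le_nhds)
    filter_upwards [hev (p k)] with z hz
    exact (e0 z hz).symm
  · refine tendsto_nhds_unique (h3' k) (Tendsto.const_mul _ ?_)
    refine Tendsto.congr' ?_ ((differentiableAt_simplePoles p _ w
      fun j => (hp j k).symm).continuousAt.tendsto.mono_left nhdsWithin_le_nhds)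
    filter_upwards [hev (conj (p k))] with z hz
    exact (e1 z hz).symm

theorem IsRowSolution.hasResidueRelation (hp : ∀ j k, p j ≠ conj (p k))
    (hinj : Function.Injective p) {A B : Fin 2 → ℂ} {u w : Fin 2 → ι → ℂ}
    (h : ∀ i, IsRowSolution p a (A i) (B i) (u i) (w i)) {m : ℂ → Matrix (Fin 2) (Fin 2) ℂ}
    (hm0 : ∀ z i, m z i 0 = simplePoles (fun j => conj (p j)) (A i) (u i) z)
    (hm1 : ∀ z i, m z i 1 = simplePoles p (B i) (w i) z) (k : ι) :
    DiscreteData.HasResidueRelation m (p k) !![0, a k; 0, 0] ∧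
      DiscreteData.HasResidueRelation m (conj (p k)) !![0, 0; -conj (a k), 0] := by
  rw [hasResidueRelation_upper_iff, hasResidueRelation_lower_iff]
  simp only [hm0, hm1]
  have hl : ∀ i, ContinuousAt (simplePoles (fun j => conj (p j)) (A i) (u i)) (p k) := fun i =>
    (differentiableAt_simplePoles _ _ _ fun j => hp k j).continuousAt
  have hr : ∀ i, ContinuousAt (simplePoles p (B i) (w i)) (conj (p k)) := fun i =>
    (differentiableAt_simplePoles _ _ _ fun j => (hp j k).symm).continuousAt
  have hz : ∀ {f : ℂ → ℂ} {c : ℂ}, ContinuousAt f c →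
      Tendsto (fun w => (w - c) * f w) (𝓝[≠] c) (𝓝 0) := fun {f c} hf => by
    have : ContinuousAt (fun w => (w - c) * f w) c :=
      (continuousAt_id.sub continuousAt_const).mul hf
    simpa using this.tendsto.mono_left (nhdsWithin_le_nhds (s := {c}ᶜ))
  refine ⟨fun i => ⟨w i k, hz (hl i), tendsto_sub_mul_simplePoles p hinj _ _ k, ?_⟩,
    fun i => ⟨u i k, hz (hr i), tendsto_sub_mul_simplePoles (fun j => conj (p j))
      (fun i j h => hinj ((starRingEnd ℂ).injective h)) _ _ k, ?_⟩⟩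
  · rw [(h i).right k]
    exact ((hl i).tendsto.mono_left nhdsWithin_le_nhds).const_mul _
  · rw [(h i).left k]
    exact ((hr i).tendsto.mono_left nhdsWithin_le_nhds).const_mul _

end NodeRelations

/-! ### The renormalized problem in terms of nodes; unique solvability. -/

namespace DiscreteData

variable {ι : Type*}

/-- The pole of the second column of a solution belonging to the index `k`. -/
noncomputable def node (D : DiscreteData ι) (Δ : Set ι) (k : ι) : ℂ :=
  open Classical in
  if k ∈ Δ then conj (D.z k) else D.z k

/-- The ratio of the residue of the second column to the value of the first one at `node k`. -/
noncomputable def coef [Fintype ι] (D : DiscreteData ι) (Δ : Set ι) (y t : ℝ) (k : ι) : ℂ :=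
  open Classical in
  if k ∈ Δ then -conj ((D.gam y t k)⁻¹ * ((deriv (D.aDelta Δ) (D.z k)) ^ 2)⁻¹)
  else D.gam y t k * (D.aDelta Δ (D.z k)) ^ 2

theorem sigma2_mul_mul_sigma2 (M : Matrix (Fin 2) (Fin 2) ℂ) :
    sigma2 * M * sigma2 = !![M 1 1, -M 1 0; -M 0 1, M 0 0] := by
  rw [sigma2, Matrix.eta_fin_two M, Matrix.mul_fin_two, Matrix.mul_fin_two]
  simp only [Matrix.of_apply, Matrix.cons_val', Matrix.cons_val_zero, Matrix.cons_val_one,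
    Matrix.cons_val_fin_one]
  congr 2 <;> ring_nf <;> simp [Complex.I_sq]

theorem node_ne_conj_node {D : DiscreteData ι} (him : ∀ k, 0 < (D.z k).im)
    (hinj : Function.Injective D.z) (Δ : Set ι) (j k : ι) :
    D.node Δ j ≠ conj (D.node Δ k) := by
  have hj := him j
  have hk := him k
  intro h
  unfold node at h
  split_ifs at h with h1 h2 h2
  · have := congrArg Complex.im h
    simp only [Complex.conj_conj, Complex.conj_im] at this
    linarith
  · exact h2 (hinj ((starRingEnd ℂ).injective h) ▸ h1)
  · rw [Complex.conj_conj] at h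
    exact h1 (hinj h ▸ h2)
  · have := congrArg Complex.im h
    simp only [Complex.conj_im] at this
    linarith

theorem node_injective {D : DiscreteData ι} (him : ∀ k, 0 < (D.z k).im)
    (hinj : Function.Injective D.z) (Δ : Set ι) : Function.Injective (D.node Δ) := by
  intro j k h
  have hj := him j
  have hk := him k
  unfold node at h
  split_ifs at h with h1 h2 h2
  · exact hinj ((starRingEnd ℂ).injective h)
  · have := congrArg Complex.im h
    simp only [Complex.conj_im] at this
    linarith
  · have := congrArg Complex.im h
    simp only [Complex.conj_im] at this
    linarith
  · exact hinj h

theorem poles_eq_node (D : DiscreteData ι) (Δ : Set ι) :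
    D.poles = {w | ∃ k, w = D.node Δ k ∨ w = conj (D.node Δ k)} := by
  ext w
  refine exists_congr fun k => ?_
  unfold node
  split_ifs
  · rw [Complex.conj_conj, or_comm]
  · rfl

theorem notMem_poles_iff (D : DiscreteData ι) (Δ : Set ι) {w : ℂ} :
    w ∉ D.poles ↔ ∀ k, w ≠ D.node Δ k ∧ w ≠ conj (D.node Δ k) := by
  rw [D.poles_eq_node Δ]
  simp [not_or]

section Fintype

variable [Fintype ι]

/-- For `k ∈ Δ` the two relations merely trade places: conjugation by `σ₂` turns a lower triangular
residue matrix into an upper triangular one, with minus the conjugate entry. -/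
theorem residue_iff_node {D : DiscreteData ι} {Δ : Set ι} {y t : ℝ}
    {m : ℂ → Matrix (Fin 2) (Fin 2) ℂ} (k : ι) :
    HasResidueRelation m (D.z k) (D.tau Δ y t k) ∧
        HasResidueRelation m (conj (D.z k)) (D.tauHat Δ y t k) ↔
      HasResidueRelation m (D.node Δ k) !![0, D.coef Δ y t k; 0, 0] ∧
        HasResidueRelation m (conj (D.node Δ k)) !![0, 0; -conj (D.coef Δ y t k), 0] := by
  rw [tauHat, sigma2_mul_mul_sigma2]
  by_cases h : k ∈ Δ
  · simp [tau, node, coef, h, and_comm]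
  · simp [tau, node, coef, h]

theorem IsSolution.exists_isRowSolution {D : DiscreteData ι} (him : ∀ k, 0 < (D.z k).im)
    (hinj : Function.Injective D.z) {Δ : Set ι} {y t : ℝ} {m : ℂ → Matrix (Fin 2) (Fin 2) ℂ}
    (hm : D.IsSolution Δ y t m) (i : Fin 2) :
    ∃ u w, IsRowSolution (D.node Δ) (D.coef Δ y t) ((1 : Matrix (Fin 2) (Fin 2) ℂ) i 0)
      ((1 : Matrix (Fin 2) (Fin 2) ℂ) i 1) u w ∧
      ∀ z ∉ D.poles,
        m z i 0 = simplePoles (fun j => conj (D.node Δ j))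
          ((1 : Matrix (Fin 2) (Fin 2) ℂ) i 0) u z ∧
        m z i 1 = simplePoles (D.node Δ) ((1 : Matrix (Fin 2) (Fin 2) ℂ) i 1) w z := by
  obtain ⟨u, w, h, h'⟩ := exists_isRowSolution_of_residues (node_ne_conj_node him hinj Δ)
    (node_injective him hinj Δ) i (fun j => D.poles_eq_node Δ ▸ hm.analytic i j)
    (fun j => hm.normalized i j)
    (fun k => ((residue_iff_node k).1 ⟨hm.residue k, hm.residue_conj k⟩).1)
    (fun k => ((residue_iff_node k).1 ⟨hm.residue k, hm.residue_conj k⟩).2)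
  exact ⟨u, w, h, fun z hz => h' z ((D.notMem_poles_iff Δ).1 hz)⟩

/-- One row with value `(1, 0)` suffices for existence: `conj_swap` supplies the other, giving the
first symmetry by construction, and uniqueness of the row against its `reflect` gives the second. -/
theorem uniquelySolvable_of_reflection {D : DiscreteData ι} (him : ∀ k, 0 < (D.z k).im)
    (hinj : Function.Injective D.z) {Δ : Set ι} {y t : ℝ} (σ : ι ≃ ι)
    (hσ : ∀ k, D.node Δ (σ k) = -conj (D.node Δ k))
    (ha : ∀ k, D.coef Δ y t (σ k) = -conj (D.coef Δ y t k)) : D.UniquelySolvable Δ y t := by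
  have hp := node_ne_conj_node him hinj Δ
  have hi := node_injective him hinj Δ
  refine ⟨?_, fun m m' hm hm' z hz => ?_⟩
  · obtain ⟨u, w, h⟩ := IsRowSolution.exists_solution (a := D.coef Δ y t) hp hi 1 0
    set r₁ := simplePoles (fun j => conj (D.node Δ j)) 1 u with hr₁
    set r₂ := simplePoles (D.node Δ) 0 w with hr₂
    obtain ⟨hu, hw⟩ := IsRowSolution.unique hp hi h (by simpa using h.reflect σ hσ ha)
    have s₁ : ∀ z, conj (r₁ (-conj z)) = r₁ z := fun z => by
      rw [hr₁, ← simplePoles_reflect σ (by simp [hσ]), ← hu, map_one]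
    have s₂ : ∀ z, conj (r₂ (-conj z)) = r₂ z := fun z => by
      rw [hr₂, ← simplePoles_reflect σ hσ, ← hw, map_zero]
    have c₁ : ∀ z, conj (r₁ (conj z)) = simplePoles (D.node Δ) 1 (fun k => conj (u k)) z :=
      fun z => by
        rw [hr₁, conj_simplePoles]
        simp
    have c₂ : ∀ z, -conj (r₂ (conj z)) =
        simplePoles (fun j => conj (D.node Δ j)) 0 (fun k => -conj (w k)) z := fun z => by
      rw [hr₂, conj_simplePoles]
      simp [simplePoles, neg_div, Finset.sum_neg_distrib]
    have hrow : ∀ i : Fin 2, IsRowSolution (D.node Δ) (D.coef Δ y t)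
        ((1 : Matrix (Fin 2) (Fin 2) ℂ) i 0) ((1 : Matrix (Fin 2) (Fin 2) ℂ) i 1)
        ((![u, fun k => -conj (w k)] : Fin 2 → ι → ℂ) i)
        ((![w, fun k => conj (u k)] : Fin 2 → ι → ℂ) i) := by
      refine Fin.forall_fin_two.2 ⟨?_, ?_⟩
      · simpa using h
      · simpa using h.conj_swap
    let m : ℂ → Matrix (Fin 2) (Fin 2) ℂ := fun z =>
      !![r₁ z, r₂ z; -conj (r₂ (conj z)), conj (r₁ (conj z))]
    have hm0 : ∀ z i, m z i 0 = simplePoles (fun j => conj (D.node Δ j))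
        ((1 : Matrix (Fin 2) (Fin 2) ℂ) i 0)
        ((![u, fun k => -conj (w k)] : Fin 2 → ι → ℂ) i) z := by
      refine fun z => Fin.forall_fin_two.2 ⟨?_, ?_⟩
      · simp [m, hr₁]
      · simpa [m] using c₂ z
    have hm1 : ∀ z i, m z i 1 = simplePoles (D.node Δ)
        ((1 : Matrix (Fin 2) (Fin 2) ℂ) i 1)
        ((![w, fun k => conj (u k)] : Fin 2 → ι → ℂ) i) z := by
      refine fun z => Fin.forall_fin_two.2 ⟨?_, ?_⟩
      · simp [m, hr₂]
      · simpa [m] using c₁ z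
    have hres := fun k => (residue_iff_node k).2
      (IsRowSolution.hasResidueRelation hp hi hrow hm0 hm1 k)
    refine ⟨m, ⟨?_, ?_, ?_, ?_, fun k => (hres k).1, fun k => (hres k).2⟩⟩
    · intro i j z hz
      have hz' := (D.notMem_poles_iff Δ).1 hz
      fin_cases j
      · simp only [Fin.zero_eta, hm0]
        exact (differentiableAt_simplePoles _ _ _ fun k => (hz' k).2).differentiableWithinAt
      · simp only [Fin.mk_one, hm1]
        exact (differentiableAt_simplePoles _ _ _ fun k => (hz' k).1).differentiableWithinAt
    · intro z _
      rw [sigma2_mul_mul_sigma2]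
      simp [m]
    · intro z _
      ext i j
      fin_cases i <;> fin_cases j
      · simpa [m] using (s₁ z).symm
      · simpa [m] using (s₂ z).symm
      · simpa [m] using (congrArg conj (s₂ (conj z))).symm
      · simpa [m] using (congrArg conj (s₁ (conj z))).symm
    · intro i j
      fin_cases j
      · simp only [Fin.zero_eta, hm0]
        exact simplePoles_sub_isBigO _ _ _
      · simp only [Fin.mk_one, hm1]
        exact simplePoles_sub_isBigO _ _ _
  · ext i j
    obtain ⟨u, w, h, hu⟩ := hm.exists_isRowSolution him hinj i
    obtain ⟨u', w', h', hu'⟩ := hm'.exists_isRowSolution him hinj i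
    obtain ⟨rfl, rfl⟩ := IsRowSolution.unique hp hi h h'
    fin_cases j
    · exact (hu z hz).1.trans (hu' z hz).1.symm
    · exact (hu z hz).2.trans (hu' z hz).2.symm

end Fintype

end DiscreteData

/-! ### Reflection symmetry of nodes and coefficients. -/

namespace DiscreteData

theorem IsReflectionless.exists_reflection {ι : Type*} {D : DiscreteData ι}
    (hD : D.IsReflectionless) :
    ∃ σ : ι ≃ ι, ∀ k, D.z (σ k) = -conj (D.z k) ∧ D.c (σ k) = -conj (D.c k) := by
  choose σ hz hc using hD.symm
  have hinv : Function.Involutive σ := fun k => hD.injective (by rw [hz, hz]; simp)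
  exact ⟨hinv.toPerm, fun k => ⟨hz k, hc k⟩⟩

theorem tTheta_neg_conj (y t : ℝ) (z : ℂ) : tTheta y t (-conj z) = -conj (tTheta y t z) := by
  simp only [tTheta, map_sub, map_mul, map_div₀, Complex.conj_ofReal, map_ofNat, mul_neg, div_neg,
    neg_mul]
  ring

section Reflection

variable {ι : Type*} {D : DiscreteData ι} {σ : ι ≃ ι}

theorem gam_reflection (hσ : ∀ k, D.z (σ k) = -conj (D.z k) ∧ D.c (σ k) = -conj (D.c k))
    (y t : ℝ) (k : ι) : D.gam y t (σ k) = -conj (D.gam y t k) := by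
  rw [gam, gam, (hσ k).1, (hσ k).2, tTheta_neg_conj, map_mul, ← Complex.exp_conj, map_mul, map_mul,
    Complex.conj_I, map_ofNat]
  ring_nf

theorem node_reflection (hσ : ∀ k, D.z (σ k) = -conj (D.z k)) {Δ : Set ι}
    (hΔ : ∀ k, σ k ∈ Δ ↔ k ∈ Δ) (k : ι) : D.node Δ (σ k) = -conj (D.node Δ k) := by
  by_cases h : k ∈ Δ
  · simp [node, h, (hΔ k).2 h, hσ]
  · simp [node, h, mt (hΔ k).1 h, hσ]

theorem mem_deltaMinus_reflection (hσ : ∀ k, D.z (σ k) = -conj (D.z k)) (y t : ℝ) (k : ι) :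
    σ k ∈ D.deltaMinus y t ↔ k ∈ D.deltaMinus y t := by
  simp only [deltaMinus, Set.mem_ofPred_eq, hσ, norm_neg, RCLike.norm_conj]

variable [Fintype ι]

theorem aDelta_neg_conj (hσ : ∀ k, D.z (σ k) = -conj (D.z k)) {Δ : Set ι}
    (hΔ : ∀ k, σ k ∈ Δ ↔ k ∈ Δ) (z : ℂ) : D.aDelta Δ (-conj z) = conj (D.aDelta Δ z) := by
  classical
  rw [aDelta, aDelta, map_prod, Finset.prod_filter, Finset.prod_filter, ← Equiv.prod_comp σ]
  refine Finset.prod_congr rfl fun k _ => ?_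
  simp only [hΔ]
  split_ifs with h
  · rw [hσ, map_div₀, map_sub, map_sub, map_neg, Complex.conj_conj, ← neg_div_neg_eq]
    congr 1 <;> ring
  · rfl

theorem deriv_aDelta_neg_conj (hσ : ∀ k, D.z (σ k) = -conj (D.z k)) {Δ : Set ι}
    (hΔ : ∀ k, σ k ∈ Δ ↔ k ∈ Δ) (z : ℂ) :
    deriv (D.aDelta Δ) (-conj z) = -conj (deriv (D.aDelta Δ) z) := by
  have h1 : (fun x => D.aDelta Δ (-x)) = conj ∘ D.aDelta Δ ∘ conj := by
    funext x
    simpa using aDelta_neg_conj hσ hΔ (conj x)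
  have h2 := congrArg (fun f => deriv f (conj z)) h1
  simp only [deriv_comp_neg, deriv_conj_conj, Function.comp_apply, Complex.conj_conj] at h2
  rw [← h2, neg_neg]

theorem coef_reflection (hσ : ∀ k, D.z (σ k) = -conj (D.z k) ∧ D.c (σ k) = -conj (D.c k))
    {Δ : Set ι} (hΔ : ∀ k, σ k ∈ Δ ↔ k ∈ Δ) (y t : ℝ) (k : ι) :
    D.coef Δ y t (σ k) = -conj (D.coef Δ y t k) := by
  have h1 := aDelta_neg_conj (fun k => (hσ k).1) hΔ (D.z k)
  have h2 := deriv_aDelta_neg_conj (fun k => (hσ k).1) hΔ (D.z k)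
  by_cases h : k ∈ Δ
  · simp only [coef, h, (hΔ k).2 h, if_true, gam_reflection hσ, (hσ k).1, h2, map_mul, map_inv₀,
      map_pow, map_neg, Complex.conj_conj, neg_sq, inv_neg]
    ring
  · simp only [coef, h, mt (hΔ k).1 h, if_false, gam_reflection hσ, (hσ k).1, h1, map_mul,
      map_pow]
    ring

end Reflection

/-! ### The localized data as the full system with zero coefficients. -/

section Localized

variable {ι : Type*} [Fintype ι]

theorem differentiableAt_aDelta {D : DiscreteData ι} (him : ∀ k, 0 < (D.z k).im) (Δ : Set ι)
    {z : ℂ} (hz : 0 < z.im) : DifferentiableAt ℂ (D.aDelta Δ) z := by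
  unfold aDelta
  refine DifferentiableAt.fun_finsetProd fun k _ => ?_
  refine (differentiableAt_id.sub_const _).div (differentiableAt_id.sub_const _)
    (sub_ne_zero.2 fun h => ?_)
  have := congrArg Complex.im h
  simp only [Complex.conj_im] at this
  linarith [him k]

theorem aDelta_eq_zero (D : DiscreteData ι) {Δ : Set ι} {k : ι} (hk : k ∈ Δ) :
    D.aDelta Δ (D.z k) = 0 := by
  classical
  exact Finset.prod_eq_zero (Finset.mem_filter.2 ⟨Finset.mem_univ k, hk⟩) (by simp)

theorem aDelta_localized_mul (D : DiscreteData ι) (Δ Δ' : Set ι) (I : Set ℂ) (z : ℂ) :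
    (D.localized Δ' I).aDelta (Subtype.val ⁻¹' Δ) z * D.aDelta {n | n ∈ Δ ∧ D.z n ∉ I} z =
      D.aDelta Δ z := by
  classical
  simp only [aDelta, Finset.prod_filter, localized, Set.mem_preimage, Set.mem_ofPred_eq]
  rw [← Fintype.prod_subtype_mul_prod_subtype (fun k => D.z k ∈ I)
      (fun k => if k ∈ Δ then (z - D.z k) / (z - conj (D.z k)) else 1),
    ← Fintype.prod_subtype_mul_prod_subtype (fun k => D.z k ∈ I)
      (fun k => if k ∈ Δ ∧ D.z k ∉ I then (z - D.z k) / (z - conj (D.z k)) else 1)]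
  rw [Finset.prod_eq_one (f := fun k : {k // D.z k ∈ I} =>
    if (k : ι) ∈ Δ ∧ D.z k ∉ I then (z - D.z k) / (z - conj (D.z k)) else 1)
    fun k _ => if_neg fun h => h.2 k.2, one_mul]
  congr 1
  · convert rfl
  · refine Finset.prod_congr rfl fun k _ => ?_
    simp [k.2]

/-- `a_Δ` is the product of its retained and discarded parts, and the discarded part squared is the
factor in `c_k(I)`. For `k ∈ Δ` the retained part vanishes at `z_k`, so the derivative of `a_Δ`
there is also a product. -/
theorem coef_localized {D : DiscreteData ι} (him : ∀ k, 0 < (D.z k).im) (Δ : Set ι) (I : Set ℂ)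
    (y t : ℝ) (k : {k // D.z k ∈ I}) :
    (D.localized Δ I).coef (Subtype.val ⁻¹' Δ) y t k = D.coef Δ y t k := by
  have hmul := D.aDelta_localized_mul Δ Δ I
  have hz : (D.localized Δ I).z k = D.z k := rfl
  have hgam : (D.localized Δ I).gam y t k =
      D.gam y t k * (D.aDelta {n | n ∈ Δ ∧ D.z n ∉ I} (D.z k)) ^ 2 := by
    simp only [gam, localized]
    ring
  by_cases h : (k : ι) ∈ Δ
  · have hd : deriv (D.aDelta Δ) (D.z k) =
        deriv ((D.localized Δ I).aDelta (Subtype.val ⁻¹' Δ)) (D.z k) *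
          D.aDelta {n | n ∈ Δ ∧ D.z n ∉ I} (D.z k) := by
      rw [← funext hmul, deriv_fun_mul, ← hz, aDelta_eq_zero _ (by exact h), zero_mul, add_zero]
      · exact differentiableAt_aDelta (D := D.localized Δ I) (fun k => him k) _ (him k)
      · exact differentiableAt_aDelta him _ (him k)
    simp only [coef, Set.mem_preimage, h, if_true, hz, hgam, hd, mul_pow, mul_inv]
    congr 2
    ring
  · simp only [coef, Set.mem_preimage, h, if_false, hz, hgam, ← hmul (D.z k), mul_pow]
    ring

theorem node_localized (D : DiscreteData ι) (Δ : Set ι) (I : Set ℂ) (k : {k // D.z k ∈ I}) :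
    (D.localized Δ I).node (Subtype.val ⁻¹' Δ) k = D.node Δ k := rfl

theorem simplePoles_subtype (s : ι → Prop) [Fintype {k // s k}] (q u : ι → ℂ) (A z : ℂ)
    (hu : ∀ k, ¬ s k → u k = 0) :
    simplePoles (fun k : {k // s k} => q k) A (fun k => u k) z = simplePoles q A u z := by
  classical
  rw [simplePoles, simplePoles, ← Fintype.sum_subtype_add_sum_subtype s (fun k => u k / (z - q k)),
    Finset.sum_eq_zero (s := Finset.univ) (f := fun k : {k // ¬ s k} => u k / (z - q k))
      fun k _ => by rw [hu k k.2, zero_div], add_zero]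
  congr 1
  exact Finset.sum_congr (by ext; simp) fun _ _ => rfl

/-- Extending by zero coefficients adds only zero residues, so both problems can be compared on one
set of nodes. -/
theorem isRowSolution_subtype {s : ι → Prop} [Fintype {k // s k}] {p a : ι → ℂ} {A B : ℂ}
    {u w : {k // s k} → ℂ} (h : IsRowSolution (fun k : {k // s k} => p k) (fun k => a k) A B u w) :
    ∃ u' w' : ι → ℂ, IsRowSolution p (fun k => open Classical in if s k then a k else 0) A B u' w' ∧
      (∀ z, simplePoles (fun k : {k // s k} => conj (p k)) A u z =
        simplePoles (fun k => conj (p k)) A u' z) ∧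
      ∀ z, simplePoles (fun k : {k // s k} => p k) B w z = simplePoles p B w' z := by
  classical
  let u' : ι → ℂ := fun k => if h : s k then u ⟨k, h⟩ else 0
  let w' : ι → ℂ := fun k => if h : s k then w ⟨k, h⟩ else 0
  have hu : u = fun k : {k // s k} => u' k := by
    funext k; simp [u', k.2]
  have hw : w = fun k : {k // s k} => w' k := by
    funext k; simp [w', k.2]
  have e1 : ∀ z, simplePoles (fun k : {k // s k} => conj (p k)) A u z =
      simplePoles (fun k => conj (p k)) A u' z := fun z => by
    rw [hu]
    exact simplePoles_subtype s (fun k => conj (p k)) u' A z fun k hk => by simp [u', hk]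
  have e2 : ∀ z, simplePoles (fun k : {k // s k} => p k) B w z = simplePoles p B w' z := fun z => by
    rw [hw]
    exact simplePoles_subtype s p w' B z fun k hk => by simp [w', hk]
  refine ⟨u', w', ⟨fun k => ?_, fun k => ?_⟩, e1, e2⟩
  · by_cases hk : s k
    · simpa [w', hk, ← e1] using h.right ⟨k, hk⟩
    · simp [w', hk]
  · by_cases hk : s k
    · simpa [u', hk, ← e2] using h.left ⟨k, hk⟩
    · simp [u', hk]

theorem uniquelySolvable {D : DiscreteData ι} (hD : D.IsReflectionless) (y t : ℝ) :
    D.UniquelySolvable (D.deltaMinus y t) y t := by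
  obtain ⟨σ, hσ⟩ := hD.exists_reflection
  have hΔ := mem_deltaMinus_reflection (fun k => (hσ k).1) y t
  exact uniquelySolvable_of_reflection hD.im_pos hD.injective σ
    (node_reflection (fun k => (hσ k).1) hΔ) (coef_reflection hσ hΔ y t)

theorem uniquelySolvable_localized {D : DiscreteData ι} (hD : D.IsReflectionless) {I : Set ℂ}
    (hI : ∀ z, -conj z ∈ I ↔ z ∈ I) (y t : ℝ) :
    (D.localized (D.deltaMinus y t) I).UniquelySolvable (Subtype.val ⁻¹' D.deltaMinus y t) y t := by
  obtain ⟨σ, hσ⟩ := hD.exists_reflection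
  have hΔ := mem_deltaMinus_reflection (fun k => (hσ k).1) y t
  refine uniquelySolvable_of_reflection (D := D.localized (D.deltaMinus y t) I)
    (fun k => hD.im_pos k) (fun _ _ h => Subtype.ext (hD.injective h))
    (Equiv.Perm.subtypePerm (p := fun k => D.z k ∈ I) σ fun k => by rw [(hσ k).1, hI])
    (fun k => ?_) fun k => ?_
  · rw [node_localized, node_localized]
    exact node_reflection (fun k => (hσ k).1) hΔ k
  · rw [coef_localized hD.im_pos, coef_localized hD.im_pos]
    exact coef_reflection hσ hΔ y t k

end Localized

end DiscreteData

/-! ### Comparison of two solutions with the same nodes. -/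

namespace IsRowSolution

variable {ι : Type*} [Fintype ι] {p a b : ι → ℂ}

/-- The entries of `m m'⁻¹ - 1` for two solutions `m`, `m'` with the same nodes and the
coefficients `a`, `b`; `(u, w)` are the residues of a row of `m` and `(u', w')` those of a row
of `m'`. -/
noncomputable def mismatch (p a b : ι → ℂ) (A B A' B' : ℂ) (u w u' w' : ι → ℂ) (z : ℂ) : ℂ :=
  ∑ k, (a k - b k) * simplePoles (fun j => conj (p j)) A u (p k) *
      conj (simplePoles p B' w' (conj (p k))) / (z - p k) +
    ∑ k, conj (b k - a k) * simplePoles p B w (conj (p k)) *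
      conj (simplePoles (fun j => conj (p j)) A' u' (p k)) / (z - conj (p k))

theorem eq_one_add_mul (hp : ∀ j k, p j ≠ conj (p k)) {u w u' w' : Fin 2 → ι → ℂ}
    (hr : ∀ i, IsRowSolution p a ((1 : Matrix (Fin 2) (Fin 2) ℂ) i 0)
      ((1 : Matrix (Fin 2) (Fin 2) ℂ) i 1) (u i) (w i))
    (hs : ∀ i, IsRowSolution p b ((1 : Matrix (Fin 2) (Fin 2) ℂ) i 0)
      ((1 : Matrix (Fin 2) (Fin 2) ℂ) i 1) (u' i) (w' i))
    {z : ℂ} (hz : ∀ k, z ≠ p k ∧ z ≠ conj (p k)) {M M' : Matrix (Fin 2) (Fin 2) ℂ}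
    (hM : ∀ i, M i 0 = simplePoles (fun j => conj (p j))
        ((1 : Matrix (Fin 2) (Fin 2) ℂ) i 0) (u i) z ∧
      M i 1 = simplePoles p ((1 : Matrix (Fin 2) (Fin 2) ℂ) i 1) (w i) z)
    (hM' : ∀ i, M' i 0 = simplePoles (fun j => conj (p j))
        ((1 : Matrix (Fin 2) (Fin 2) ℂ) i 0) (u' i) z ∧
      M' i 1 = simplePoles p ((1 : Matrix (Fin 2) (Fin 2) ℂ) i 1) (w' i) z) :
    M = (1 + Matrix.of fun i j => mismatch p a b ((1 : Matrix (Fin 2) (Fin 2) ℂ) i 0)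
      ((1 : Matrix (Fin 2) (Fin 2) ℂ) i 1) ((1 : Matrix (Fin 2) (Fin 2) ℂ) j 0)
      ((1 : Matrix (Fin 2) (Fin 2) ℂ) j 1) (u i) (w i) (u' j) (w' j) z) * M' := by
  -- `Q` is the adjoint of `M'` at `conj z`. The pairing with equal coefficients shows that it
  -- inverts `M'`.
  let Q : Matrix (Fin 2) (Fin 2) ℂ := Matrix.of fun l j =>
    if l = 0 then conj (simplePoles (fun j => conj (p j))
      ((1 : Matrix (Fin 2) (Fin 2) ℂ) j 0) (u' j) (conj z))
    else conj (simplePoles p ((1 : Matrix (Fin 2) (Fin 2) ℂ) j 1) (w' j) (conj z))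
  have hone : ∀ i j : Fin 2, (1 : Matrix (Fin 2) (Fin 2) ℂ) i 0 *
      conj ((1 : Matrix (Fin 2) (Fin 2) ℂ) j 0) + (1 : Matrix (Fin 2) (Fin 2) ℂ) i 1 *
      conj ((1 : Matrix (Fin 2) (Fin 2) ℂ) j 1) = (1 : Matrix (Fin 2) (Fin 2) ℂ) i j := by
    simp only [Fin.forall_fin_two]
    simp
  have h1 : M * Q = 1 + Matrix.of fun i j => mismatch p a b
      ((1 : Matrix (Fin 2) (Fin 2) ℂ) i 0)
      ((1 : Matrix (Fin 2) (Fin 2) ℂ) i 1) ((1 : Matrix (Fin 2) (Fin 2) ℂ) j 0)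
      ((1 : Matrix (Fin 2) (Fin 2) ℂ) j 1) (u i) (w i) (u' j) (w' j) z := by
    ext i j
    have := (hr i).mul_conj_add_mul_conj hp (hs j) (fun k => (hz k).1) fun k => (hz k).2
    rw [hone, ← (hM i).1, ← (hM i).2] at this
    simpa [Matrix.mul_apply, Fin.sum_univ_two, Q, mismatch] using this
  have h2 : M' * Q = 1 := by
    ext i j
    have := (hs i).mul_conj_add_mul_conj hp (hs j) (fun k => (hz k).1) fun k => (hz k).2
    rw [hone, ← (hM' i).1, ← (hM' i).2] at this
    simpa [Matrix.mul_apply, Fin.sum_univ_two, Q] using this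
  rw [← h1, mul_assoc, mul_eq_one_comm.1 h2, mul_one]

/-- The values of the rows at the nodes are bounded independently of the coefficients, and nodes
with `a k = b k` drop out, so `z` must be kept away from the others only. -/
theorem exists_norm_mismatch_le (hp : ∀ j k, p j ≠ conj (p k)) (hinj : Function.Injective p) :
    ∃ V : ℝ, 0 ≤ V ∧ ∀ (a b : ι → ℂ) (A B A' B' : ℂ) (u w u' w' : ι → ℂ),
      IsRowSolution p a A B u w → IsRowSolution p b A' B' u' w' →
      ‖A‖ ^ 2 + ‖B‖ ^ 2 ≤ 1 → ‖A'‖ ^ 2 + ‖B'‖ ^ 2 ≤ 1 → ∀ z : ℂ, ∀ ε > 0,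
      (∀ k, a k ≠ b k → ε ≤ ‖z - p k‖ ∧ ε ≤ ‖z - conj (p k)‖) →
      ‖mismatch p a b A B A' B' u w u' w' z‖ ≤ (∑ k, ‖a k - b k‖) * (V / ε) := by
  obtain ⟨K, hK, H⟩ := residues_le hp hinj
  let S : ℝ := ∑ k, ∑ j, (1 / ‖p k - conj (p j)‖ + 1 / ‖conj (p k) - p j‖)
  have hS1 : ∀ k, ∑ j, 1 / ‖p k - conj (p j)‖ ≤ S := fun k =>
    (Finset.sum_le_sum fun j _ => le_add_of_nonneg_right (by positivity)).trans
      (Finset.single_le_sum (f := fun k => ∑ j,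
        (1 / ‖p k - conj (p j)‖ + 1 / ‖conj (p k) - p j‖)) (fun k _ => by positivity)
        (Finset.mem_univ k))
  have hS2 : ∀ k, ∑ j, 1 / ‖conj (p k) - p j‖ ≤ S := fun k =>
    (Finset.sum_le_sum fun j _ => le_add_of_nonneg_left (by positivity)).trans
      (Finset.single_le_sum (f := fun k => ∑ j,
        (1 / ‖p k - conj (p j)‖ + 1 / ‖conj (p k) - p j‖)) (fun k _ => by positivity)
        (Finset.mem_univ k))
  have hS : 0 ≤ S := by positivity
  let W : ℝ := 1 + K * S
  have hW : 0 ≤ W := by positivity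
  have hval : ∀ (a : ι → ℂ) (A B : ℂ) (u w : ι → ℂ), IsRowSolution p a A B u w →
      ‖A‖ ^ 2 + ‖B‖ ^ 2 ≤ 1 → ∀ k, ‖simplePoles (fun j => conj (p j)) A u (p k)‖ ≤ W ∧
        ‖simplePoles p B w (conj (p k))‖ ≤ W := by
    intro a A B u w hr hAB k
    have hA : ‖A‖ ≤ 1 := by nlinarith [sq_nonneg ‖B‖, norm_nonneg A]
    have hB : ‖B‖ ≤ 1 := by nlinarith [sq_nonneg ‖A‖, norm_nonneg B]
    exact ⟨(norm_simplePoles_le _ A u fun j => (H a A B u w hr hAB j).1).trans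
        (add_le_add hA (mul_le_mul_of_nonneg_left (hS1 k) hK)),
      (norm_simplePoles_le _ B w fun j => (H a A B u w hr hAB j).2).trans
        (add_le_add hB (mul_le_mul_of_nonneg_left (hS2 k) hK))⟩
  refine ⟨2 * W ^ 2, by positivity, ?_⟩
  intro a b A B A' B' u w u' w' hr hs hAB hAB' z ε hε hz
  have hterm : ∀ (c x x' d : ℂ), ‖x‖ ≤ W → ‖x'‖ ≤ W → (c ≠ 0 → ε ≤ ‖d‖) →
      ‖c * x * conj x' / d‖ ≤ ‖c‖ * (W ^ 2 / ε) := by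
    intro c x x' d hx hx' hd
    by_cases hc : c = 0
    · simp [hc]
    · rw [norm_div, norm_mul, norm_mul, RCLike.norm_conj, mul_assoc, mul_div_assoc, sq]
      have := hd hc
      gcongr
  refine (norm_add_le _ _).trans ?_
  have e1 : ‖∑ k, (a k - b k) * simplePoles (fun j => conj (p j)) A u (p k) *
      conj (simplePoles p B' w' (conj (p k))) / (z - p k)‖ ≤ ∑ k, ‖a k - b k‖ * (W ^ 2 / ε) :=
    norm_sum_le_of_le _ fun k _ => hterm _ _ _ _ (hval a A B u w hr hAB k).1
      (hval b A' B' u' w' hs hAB' k).2 fun h => (hz k (sub_ne_zero.1 h)).1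
  have e2 : ‖∑ k, conj (b k - a k) * simplePoles p B w (conj (p k)) *
      conj (simplePoles (fun j => conj (p j)) A' u' (p k)) / (z - conj (p k))‖ ≤
      ∑ k, ‖a k - b k‖ * (W ^ 2 / ε) :=
    norm_sum_le_of_le _ fun k _ => (hterm _ _ _ _ (hval a A B u w hr hAB k).2
      (hval b A' B' u' w' hs hAB' k).1 fun h => (hz k fun h' => h (by simp [h'])).2).trans
      (by rw [RCLike.norm_conj, norm_sub_rev])
  rw [← Finset.sum_mul] at e1 e2
  calc _ ≤ _ := add_le_add e1 e2
    _ = _ := by ring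

end IsRowSolution

/-! ### Exponential decay of the coefficients in the cone. -/

namespace DiscreteData

theorem im_tTheta (y t : ℝ) (z : ℂ) :
    (tTheta y t z).im = z.im * (y + t / (4 * ‖z‖ ^ 2)) := by
  have h : tTheta y t z = z * (y : ℂ) - ((t / 4 : ℝ) : ℂ) * z⁻¹ := by
    rw [tTheta]
    push_cast
    rw [div_mul_eq_div_div, div_eq_mul_inv _ z]
  rw [h, Complex.sub_im, Complex.im_mul_ofReal, Complex.im_ofReal_mul, Complex.inv_im,
    Complex.normSq_eq_norm_sq, div_mul_eq_div_div]
  ring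

theorem norm_gam {ι : Type*} (D : DiscreteData ι) (y t : ℝ) (k : ι) :
    ‖D.gam y t k‖ = ‖D.c k‖ * Real.exp (-2 * (D.z k).im * (y + t / (4 * ‖D.z k‖ ^ 2))) := by
  have h : (2 * Complex.I * tTheta y t (D.z k)).re =
      -2 * (D.z k).im * (y + t / (4 * ‖D.z k‖ ^ 2)) := by
    have : (2 * Complex.I * tTheta y t (D.z k)).re = -2 * (tTheta y t (D.z k)).im := by
      simp
    rw [this, im_tTheta]
    ring
  rw [gam, norm_mul, Complex.norm_exp, h]

/-- The bracket is `t (ξ + 1/(4|z_k|²))`, which changes sign at `|z_k| = z₀`. Hence `Δ⁻` picks out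
indices whose `γ_k` does not decay, and renormalization inverts these. -/
theorem mem_deltaMinus_sign {ι : Type*} {D : DiscreteData ι} {y t : ℝ} (hyt : y / t < 0) {k : ι}
    (hz : 0 < ‖D.z k‖) :
    (k ∈ D.deltaMinus y t → y + t / (4 * ‖D.z k‖ ^ 2) ≤ 0) ∧
      (k ∉ D.deltaMinus y t → 0 ≤ y + t / (4 * ‖D.z k‖ ^ 2)) := by
  have hs : y + t / (4 * ‖D.z k‖ ^ 2) = t * (y / t + 1 / (4 * ‖D.z k‖ ^ 2)) := by
    have : t ≠ 0 := fun h => by simp [h] at hyt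
    field_simp
  have hpos : 0 ≤ -1 / (4 * (y / t)) := div_nonneg_of_nonpos (by norm_num) (by linarith)
  have h1 : ‖D.z k‖ ≤ zZero y t → 0 ≤ y / t + 1 / (4 * ‖D.z k‖ ^ 2) := by
    intro h
    rw [zZero, Real.le_sqrt hz.le hpos, le_div_iff_of_neg (by linarith)] at h
    have : -(y / t) ≤ 1 / (4 * ‖D.z k‖ ^ 2) := by
      rw [le_div_iff₀ (by positivity)]
      linarith
    linarith
  have h2 : zZero y t ≤ ‖D.z k‖ → y / t + 1 / (4 * ‖D.z k‖ ^ 2) ≤ 0 := by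
    intro h
    rw [zZero, Real.sqrt_le_left hz.le, div_le_iff_of_neg (by linarith)] at h
    have : 1 / (4 * ‖D.z k‖ ^ 2) ≤ -(y / t) := by
      rw [div_le_iff₀ (by positivity)]
      linarith
    linarith
  rw [hs]
  constructor
  · rintro (⟨ht, h⟩ | ⟨ht, h⟩)
    · exact mul_nonpos_of_nonneg_of_nonpos ht.le (h2 h.le)
    · exact mul_nonpos_of_nonpos_of_nonneg ht.le (h1 h.le)
  · intro h
    simp only [deltaMinus, Set.mem_ofPred_eq, not_or, not_and, not_lt] at h
    rcases lt_trichotomy t 0 with ht | ht | ht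
    · exact mul_nonneg_of_nonpos_of_nonpos ht.le (h2 (h.2 ht))
    · simp [ht]
    · exact mul_nonneg ht.le (h1 (h.1 ht))

theorem exists_norm_coef_le {ι : Type*} [Fintype ι] {D : DiscreteData ι}
    (him : ∀ k, 0 < (D.z k).im) (Δ : Set ι) (k : ι) :
    ∃ K : ℝ, 0 ≤ K ∧ ∀ y t : ℝ, y / t < 0 → D.deltaMinus y t = Δ →
      ‖D.coef Δ y t k‖ ≤
        K * Real.exp (-2 * ((D.z k).im * |y + t / (4 * ‖D.z k‖ ^ 2)|)) := by
  have hz : 0 < ‖D.z k‖ := norm_pos_iff.2 fun h => by simpa [h] using him k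
  by_cases h : k ∈ Δ
  · refine ⟨‖D.c k‖⁻¹ * ‖((deriv (D.aDelta Δ) (D.z k)) ^ 2)⁻¹‖, by positivity, fun y t hyt hΔ => ?_⟩
    subst hΔ
    have hs := (mem_deltaMinus_sign hyt hz).1 h
    simp only [coef, h, if_true]
    rw [norm_neg, RCLike.norm_conj, norm_mul, norm_inv (D.gam y t k), norm_gam, mul_inv,
      ← Real.exp_neg, abs_of_nonpos hs]
    refine le_of_eq ?_
    ring_nf
  · refine ⟨‖D.c k‖ * ‖(D.aDelta Δ (D.z k)) ^ 2‖, by positivity, fun y t hyt hΔ => ?_⟩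
    subst hΔ
    have hs := (mem_deltaMinus_sign hyt hz).2 h
    simp only [coef, h, if_false]
    rw [norm_mul, norm_gam, abs_of_nonneg hs]
    refine le_of_eq ?_
    ring_nf

/-- Compare with the radial projection onto the circle of radius `ρ`. -/
theorem infDist_closedAnnulus_le {v₁ v₂ ρ : ℝ} (hρ : 0 ≤ ρ) (h₁ : -1 / (4 * v₁) ≤ ρ ^ 2)
    (h₂ : ρ ^ 2 ≤ -1 / (4 * v₂)) {z : ℂ} (hz : 0 < ‖z‖) :
    Metric.infDist z (closedAnnulus v₁ v₂) ≤ |‖z‖ - ρ| := by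
  have hw : ‖((ρ / ‖z‖ : ℝ) : ℂ) * z‖ = ρ := by
    rw [norm_mul, Complex.norm_real, Real.norm_of_nonneg (by positivity)]
    field_simp
  refine (Metric.infDist_le_dist_of_mem (y := ((ρ / ‖z‖ : ℝ) : ℂ) * z) ?_).trans (le_of_eq ?_)
  · simp only [closedAnnulus, Set.mem_ofPred_eq, hw]
    exact ⟨h₁, h₂⟩
  · have : z - ((ρ / ‖z‖ : ℝ) : ℂ) * z = ((1 - ρ / ‖z‖ : ℝ) : ℂ) * z := by
      push_cast
      ring
    have e : ‖z‖ - ρ = (1 - ρ / ‖z‖) * ‖z‖ := by field_simp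
    rw [dist_eq_norm, this, norm_mul, Complex.norm_real, Real.norm_eq_abs, e, abs_mul,
      abs_of_pos hz]

/-- Let `ρ₁ ≤ ρ₂` be the radii of the annulus and `r = |z_k|`. Inside, `v r² + 1/4 ≥ -v₁ (ρ₁² -
r²)`; outside, `-v r² - 1/4 ≥ -v₂ (r² - ρ₂²)`. Factor the differences of squares, then use `-v₁ ≥
-v₂` or `ρ₂ ≥ ρ₁` respectively. -/
theorem rate_le {ι : Type*} {D : DiscreteData ι} (him : ∀ k, 0 < (D.z k).im) {v₁ v₂ v : ℝ}
    (hv₁ : v₁ ≤ v) (hv : v ≤ v₂) (hv₂ : v₂ < 0) {k : ι} (hk : D.z k ∉ annulus v₁ v₂) :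
    D.rate v₁ v₂ k ≤ (D.z k).im * |v + 1 / (4 * ‖D.z k‖ ^ 2)| := by
  have hz : 0 < ‖D.z k‖ := norm_pos_iff.2 fun h => by simpa [h] using him k
  have hsq : ∀ x : ℝ, x < 0 → 0 < 1 / (2 * Real.sqrt (-x)) ∧
      (1 / (2 * Real.sqrt (-x))) ^ 2 = -1 / (4 * x) ∧
      x * (1 / (2 * Real.sqrt (-x))) ^ 2 = -1 / 4 := by
    intro x hx
    have h0 : 0 < Real.sqrt (-x) := Real.sqrt_pos.2 (by linarith)
    have h1 : (1 / (2 * Real.sqrt (-x))) ^ 2 = -1 / (4 * x) := by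
      rw [div_pow, mul_pow, Real.sq_sqrt (by linarith), one_pow, div_eq_div_iff (by linarith)
        (by linarith)]
      ring
    refine ⟨by positivity, h1, ?_⟩
    rw [h1]
    have := hx.ne
    field_simp
  obtain ⟨hρ₁, hs₁, hm₁⟩ := hsq v₁ (by linarith)
  obtain ⟨hρ₂, hs₂, hm₂⟩ := hsq v₂ hv₂
  set ρ₁ := 1 / (2 * Real.sqrt (-v₁)) with hρ₁'
  set ρ₂ := 1 / (2 * Real.sqrt (-v₂)) with hρ₂'
  set r := ‖D.z k‖ with hr
  have hle : ρ₁ ≤ ρ₂ := by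
    have : Real.sqrt (-v₂) ≤ Real.sqrt (-v₁) := Real.sqrt_le_sqrt (by linarith)
    have h0 : 0 < Real.sqrt (-v₂) := Real.sqrt_pos.2 (by linarith)
    rw [hρ₁', hρ₂']
    gcongr
  have hle2 : ρ₁ ^ 2 ≤ ρ₂ ^ 2 := by gcongr
  have hout : r ≤ ρ₁ ∨ ρ₂ ≤ r := by
    simp only [annulus, Set.mem_ofPred_eq, ← hs₁, ← hs₂, not_and_or, not_lt, ← hr] at hk
    rcases hk with h | h
    · exact Or.inl ((sq_le_sq₀ hz.le hρ₁.le).1 h)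
    · exact Or.inr ((sq_le_sq₀ hρ₂.le hz.le).1 h)
  rw [rate, mul_assoc ((D.z k).im), mul_assoc ((D.z k).im)]
  refine mul_le_mul_of_nonneg_left ?_ (him k).le
  rw [← hρ₁', ← hr]
  have hc : 0 ≤ -v₂ / r ^ 2 * (r + ρ₁) := by
    have : 0 ≤ -v₂ := by linarith
    positivity
  rcases hout with h | h
  · have hd : Metric.infDist (D.z k) (closedAnnulus v₁ v₂) ≤ ρ₁ - r := by
      have := infDist_closedAnnulus_le hρ₁.le hs₁.ge (hle2.trans hs₂.le) hz
      rwa [← hr, abs_sub_comm, abs_of_nonneg (by linarith)] at this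
    calc -v₂ / r ^ 2 * (r + ρ₁) * Metric.infDist (D.z k) (closedAnnulus v₁ v₂)
        ≤ -v₂ / r ^ 2 * (r + ρ₁) * (ρ₁ - r) := mul_le_mul_of_nonneg_left hd hc
      _ ≤ v + 1 / (4 * r ^ 2) := by
        have e : v + 1 / (4 * r ^ 2) = (v * r ^ 2 + 1 / 4) / r ^ 2 := by field_simp
        rw [e, mul_assoc, div_mul_eq_mul_div]
        gcongr
        nlinarith [mul_nonneg (sub_nonneg.2 hv₁) (sq_nonneg r),
          mul_nonneg (sub_nonneg.2 (hv₁.trans hv)) (mul_nonneg (add_pos hz hρ₁).le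
            (sub_nonneg.2 h))]
      _ ≤ _ := le_abs_self _
  · have hd : Metric.infDist (D.z k) (closedAnnulus v₁ v₂) ≤ r - ρ₂ := by
      have := infDist_closedAnnulus_le hρ₂.le (hs₁.ge.trans hle2) hs₂.le hz
      rwa [← hr, abs_of_nonneg (by linarith)] at this
    calc -v₂ / r ^ 2 * (r + ρ₁) * Metric.infDist (D.z k) (closedAnnulus v₁ v₂)
        ≤ -v₂ / r ^ 2 * (r + ρ₁) * (r - ρ₂) := mul_le_mul_of_nonneg_left hd hc
      _ ≤ -(v + 1 / (4 * r ^ 2)) := by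
        have e : -(v + 1 / (4 * r ^ 2)) = (-v * r ^ 2 - 1 / 4) / r ^ 2 := by
          field_simp
          ring
        rw [e, mul_assoc, div_mul_eq_mul_div]
        gcongr
        nlinarith [mul_nonneg (sub_nonneg.2 hv) (sq_nonneg r),
          mul_nonneg (neg_nonneg.2 hv₂.le) (mul_nonneg (sub_nonneg.2 hle) (sub_nonneg.2 h))]
      _ ≤ _ := neg_le_abs _

theorem neg_conj_mem_annulus {v₁ v₂ : ℝ} (z : ℂ) : -conj z ∈ annulus v₁ v₂ ↔ z ∈ annulus v₁ v₂ := by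
  simp only [annulus, Set.mem_ofPred_eq, norm_neg, RCLike.norm_conj]

end DiscreteData

/-! ### Assembly of the localization estimate. -/

namespace DiscreteData

theorem exists_eq_one_add_mul_localized {ι : Type*} [Fintype ι] {D : DiscreteData ι}
    (hD : D.IsReflectionless) (Δ : Set ι) (I : Set ℂ) :
    ∃ V : ℝ, 0 ≤ V ∧ ∀ (y t : ℝ) (m mI : ℂ → Matrix (Fin 2) (Fin 2) ℂ),
      D.IsSolution Δ y t m → (D.localized Δ I).IsSolution (Subtype.val ⁻¹' Δ) y t mI →
      ∀ z ∉ D.poles, ∀ ε > 0,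
        (∀ k, D.z k ∉ I → ε ≤ ‖z - D.z k‖ ∧ ε ≤ ‖z - conj (D.z k)‖) →
        ∃ E : Matrix (Fin 2) (Fin 2) ℂ,
          (∀ i j, ‖E i j‖ ≤ (∑ k ∈ D.outside I, ‖D.coef Δ y t k‖) * (V / ε)) ∧
          m z = (1 + E) * mI z := by
  classical
  have hp := node_ne_conj_node hD.im_pos hD.injective Δ
  obtain ⟨V, hV, H⟩ := IsRowSolution.exists_norm_mismatch_le hp
    (node_injective hD.im_pos hD.injective Δ)
  refine ⟨V, hV, fun y t m mI hm hmI z hz ε hε hzε => ?_⟩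
  choose u w h h' using hm.exists_isRowSolution hD.im_pos hD.injective
  choose v x g g' using IsSolution.exists_isRowSolution
    (D := D.localized Δ I) (fun k => hD.im_pos k) (fun _ _ h => Subtype.ext (hD.injective h)) hmI
  have hcoef : (D.localized Δ I).coef (Subtype.val ⁻¹' Δ) y t =
      fun k : {k // D.z k ∈ I} => D.coef Δ y t k :=
    funext fun k => coef_localized hD.im_pos Δ I y t k
  have hnode : (D.localized Δ I).node (Subtype.val ⁻¹' Δ) =
      fun k : {k // D.z k ∈ I} => D.node Δ k := funext fun k => node_localized D Δ I k
  rw [hcoef, hnode] at g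
  simp only [node_localized] at g'
  choose v' x' f e₁ e₂ using fun i => isRowSolution_subtype (g i)
  have hzI : z ∉ (D.localized Δ I).poles := fun ⟨k, hk⟩ => hz ⟨k, hk⟩
  have hone : ∀ i : Fin 2, ‖(1 : Matrix (Fin 2) (Fin 2) ℂ) i 0‖ ^ 2 +
      ‖(1 : Matrix (Fin 2) (Fin 2) ℂ) i 1‖ ^ 2 ≤ 1 := by
    simp [Fin.forall_fin_two]
  refine ⟨_, fun i j => ?_, IsRowSolution.eq_one_add_mul hp h f ((D.notMem_poles_iff Δ).1 hz)
    (fun i => h' i z hz)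
    (fun i => ⟨(g' i z hzI).1.trans (e₁ i z), (g' i z hzI).2.trans ?_⟩)⟩
  · refine (H _ _ _ _ _ _ _ _ _ _ (h i) (f j) (hone i) (hone j) z ε hε fun k hk => ?_).trans
      (le_of_eq ?_)
    · have hkI : D.z k ∉ I := fun hI => hk (by simp [hI])
      obtain ⟨h1, h2⟩ := hzε k hkI
      unfold node
      split_ifs
      · exact ⟨h2, by rwa [Complex.conj_conj]⟩
      · exact ⟨h1, h2⟩
    · congr 1
      rw [outside, Finset.sum_filter]
      refine Finset.sum_congr (by ext; simp) fun k _ => ?_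
      by_cases hk : D.z k ∈ I <;> simp [hk]
  · have := e₂ i z
    exact this

/-- Along `y = y₀ + v t` the exponent differs from its value on the ray `y = v t` by at most `2
Im(z_k) Y`, which goes into the constant. -/
theorem exists_norm_coef_le_exp_mu {ι : Type*} [Fintype ι] {D : DiscreteData ι}
    (him : ∀ k, 0 < (D.z k).im) {v₁ v₂ : ℝ} (hv₂ : v₂ < 0)
    (h : (D.outside (annulus v₁ v₂)).Nonempty) (Δ : Set ι) (Y : ℝ) :
    ∃ K : ℝ, 0 ≤ K ∧ ∀ y t y₀ v : ℝ, y / t < 0 → D.deltaMinus y t = Δ → |y₀| ≤ Y →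
      v ∈ Set.Icc v₁ v₂ → y = y₀ + v * t →
      ∑ k ∈ D.outside (annulus v₁ v₂), ‖D.coef Δ y t k‖ ≤
        K * Real.exp (-2 * D.mu v₁ v₂ h * |t|) := by
  choose K hK H using exists_norm_coef_le him Δ
  refine ⟨∑ k ∈ D.outside (annulus v₁ v₂), K k * Real.exp (2 * (D.z k).im * Y),
    Finset.sum_nonneg fun k _ => mul_nonneg (hK k) (Real.exp_pos _).le, ?_⟩
  intro y t y₀ v hyt hΔ hy₀ hv hy
  rw [Finset.sum_mul]
  refine Finset.sum_le_sum fun k hk => (H k y t hyt hΔ).trans ?_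
  rw [mul_assoc, ← Real.exp_add]
  refine mul_le_mul_of_nonneg_left (Real.exp_le_exp.2 ?_) (hK k)
  have hmu : D.mu v₁ v₂ h ≤ (D.z k).im * |v + 1 / (4 * ‖D.z k‖ ^ 2)| := by
    refine (Finset.inf'_le _ hk).trans (rate_le him hv.1 hv.2 hv₂ ?_)
    simpa [outside] using hk
  have hs : |v + 1 / (4 * ‖D.z k‖ ^ 2)| * |t| - Y ≤ |y + t / (4 * ‖D.z k‖ ^ 2)| := by
    have e : y + t / (4 * ‖D.z k‖ ^ 2) = (v + 1 / (4 * ‖D.z k‖ ^ 2)) * t - -y₀ := by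
      rw [hy]
      ring
    rw [e, ← abs_mul]
    have := abs_sub_abs_le_abs_sub ((v + 1 / (4 * ‖D.z k‖ ^ 2)) * t) (-y₀)
    rw [abs_neg] at this
    linarith
  have h1 := mul_le_mul_of_nonneg_left hs (him k).le
  have h2 := mul_le_mul_of_nonneg_right hmu (abs_nonneg t)
  nlinarith

end DiscreteData

theorem mainTheorem2 (N : ℕ) (D : DiscreteData (Fin N)) (hD : D.IsReflectionless)
    (y₁ y₂ v₁ v₂ : ℝ) (hy : y₁ ≤ y₂) (hv : v₁ ≤ v₂) (hv₂ : v₂ < 0) :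
    -- both renormalized problems are uniquely solvable
    (∀ y t : ℝ, y / t < 0 →
      D.UniquelySolvable (D.deltaMinus y t) y t ∧
      (D.localized (D.deltaMinus y t) (DiscreteData.annulus v₁ v₂)).UniquelySolvable
        (Subtype.val ⁻¹' D.deltaMinus y t) y t) ∧
    -- localization with error of order `exp (-2 μ(I) |t|)`, uniformly in the cone and
    -- uniformly in `z` away from the discarded poles
    (∀ h : (D.outside (DiscreteData.annulus v₁ v₂)).Nonempty,
      ∀ ε > 0, ∃ C T : ℝ, ∀ y t : ℝ, (y, t) ∈ DiscreteData.cone y₁ y₂ v₁ v₂ → T ≤ |t| →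
        ∀ m mI : ℂ → Matrix (Fin 2) (Fin 2) ℂ,
          D.IsSolution (D.deltaMinus y t) y t m →
          (D.localized (D.deltaMinus y t) (DiscreteData.annulus v₁ v₂)).IsSolution
            (Subtype.val ⁻¹' D.deltaMinus y t) y t mI →
          ∀ z ∉ D.poles,
            (∀ k, D.z k ∉ DiscreteData.annulus v₁ v₂ →
              ε ≤ ‖z - D.z k‖ ∧ ε ≤ ‖z - (starRingEnd ℂ) (D.z k)‖) →
            ∃ E : Matrix (Fin 2) (Fin 2) ℂ,
              (∀ i j, ‖E i j‖ ≤ C * Real.exp (-2 * D.mu v₁ v₂ h * |t|)) ∧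
              m z = (1 + E) * mI z) ∧
    -- if no pole is discarded (empty minimum, `μ(I) = ∞`), there is no error at all
    (D.outside (DiscreteData.annulus v₁ v₂) = ∅ →
      ∀ y t : ℝ, y / t < 0 → ∀ m mI : ℂ → Matrix (Fin 2) (Fin 2) ℂ,
        D.IsSolution (D.deltaMinus y t) y t m →
        (D.localized (D.deltaMinus y t) (DiscreteData.annulus v₁ v₂)).IsSolution
          (Subtype.val ⁻¹' D.deltaMinus y t) y t mI →
        ∀ z ∉ D.poles, m z = mI z) := by
  refine ⟨fun y t _ => ⟨DiscreteData.uniquelySolvable hD y t,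
    DiscreteData.uniquelySolvable_localized hD DiscreteData.neg_conj_mem_annulus y t⟩, ?_, ?_⟩
  · intro h ε hε
    choose V hV HV using fun Δ =>
      DiscreteData.exists_eq_one_add_mul_localized hD Δ (DiscreteData.annulus v₁ v₂)
    choose K hK HK using fun Δ => DiscreteData.exists_norm_coef_le_exp_mu hD.im_pos hv₂ h Δ
      (max |y₁| |y₂|)
    -- The constants depend on `Δ⁻`, which varies with `y/t` but takes only finitely many values.
    obtain ⟨C, hC⟩ := Finite.exists_le fun Δ : Set (Fin N) => K Δ * (V Δ / ε)
    -- Beyond this time `|y₀| < -v₂ |t|`, which makes `y / t = y₀ / t + v` negative.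
    refine ⟨C, max |y₁| |y₂| / -v₂ + 1, ?_⟩
    rintro y t ⟨y₀, hy₀, v, hv, hyt⟩ hT m mI hm hmI z hz hzε
    have hyt : y = y₀ + v * t := hyt
    have hY : |y₀| ≤ max |y₁| |y₂| := abs_le_max_abs_abs hy₀.1 hy₀.2
    have hv₂' : 0 < -v₂ := neg_pos.2 hv₂
    have htpos : 0 < |t| := lt_of_lt_of_le (by positivity) hT
    have hneg : y / t < 0 := by
      have h1 : |y₀| < -v₂ * |t| := by
        have : max |y₁| |y₂| / -v₂ < |t| := by linarith
        rw [div_lt_iff₀ hv₂'] at this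
        linarith
      have h2 : |y₀ / t| < -v₂ := by
        rw [abs_div, div_lt_iff₀ htpos]
        exact h1
      have h3 : y / t = y₀ / t + v := by
        rw [hyt]
        have := abs_pos.1 htpos
        field_simp
      have := le_abs_self (y₀ / t)
      have := hv.2
      linarith
    obtain ⟨E, hE, hmE⟩ := HV _ y t m mI hm hmI z hz ε hε hzε
    refine ⟨E, fun i j => (hE i j).trans ?_, hmE⟩
    have hexp := Real.exp_pos (-2 * D.mu v₁ v₂ h * |t|)
    have hVε : 0 ≤ V (D.deltaMinus y t) / ε := div_nonneg (hV _) hε.le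
    calc _ ≤ K (D.deltaMinus y t) * Real.exp (-2 * D.mu v₁ v₂ h * |t|) *
          (V (D.deltaMinus y t) / ε) :=
        mul_le_mul_of_nonneg_right (HK _ y t y₀ v hneg rfl hY hv hyt) hVε
      _ = K (D.deltaMinus y t) * (V (D.deltaMinus y t) / ε) *
          Real.exp (-2 * D.mu v₁ v₂ h * |t|) := by ring
      _ ≤ _ := mul_le_mul_of_nonneg_right (hC _) hexp.le
  · intro h y t _ m mI hm hmI z hz
    obtain ⟨V, -, HV⟩ := DiscreteData.exists_eq_one_add_mul_localized hD (D.deltaMinus y t)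
      (DiscreteData.annulus v₁ v₂)
    -- With nothing discarded the distance condition is vacuous, so any positive `ε` will do, and
    -- the error bound is an empty sum.
    obtain ⟨E, hE, hmE⟩ := HV y t m mI hm hmI z hz 1 one_pos fun k hk => by
      have : k ∈ D.outside (DiscreteData.annulus v₁ v₂) := by simpa [DiscreteData.outside] using hk
      simp [h] at this
    have hE0 : E = 0 := by
      ext i j
      simpa [h] using hE i j
    rw [hmE, hE0, add_zero, one_mul]
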